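/- Let $\Theta_2$ be Joyal's 2-cell category: its objects are $[n;q_1,\dots,q_n]$ with $n,q_k\in\mathbb N$, and a morphism $[m;p_1,\dots,p_m]\to[n;q_1,\dots,q_n]$ consists of a simplicial operator $\alpha:[m]\to[n]$ together with a simplicial operator $\alpha_k:[p_\ell]\to[q_k]$ whenever $\alpha(\ell-1)<k\le\alpha(\ell)$. Write $[n;\mathbf q]$ for $[n;q_1,\dots,q_n]$ and $[0]$ for its object with $n=0$. Let $\widehat{\Theta_2}=[\Theta_2^{\mathrm{op}},\mathrm{Set}]$ be the category of cellular sets and $\Theta_2[n;\mathbf q]$ the representable presheaf. Simplicial sets are regarded as cellular sets by restriction along $\Theta_2\to\Delta$, $[\alpha;\alpha_k]\mapsto\alpha$. For a simplicial set $f:X\to\Delta[n]$ over $\Delta[n]$ and simplicial sets $S_1,\dots,S_n$, let $\square_n(X;S_1,\dots,S_n)$ be Oury's box product, the cellular set whose $[m;\mathbf p]$-cells are the $m$-simplices $w\in X_m$ together with a $p_\ell$-simplex of $S_k$ whenever $f(w)(\ell-1)<k\le f(w)(\ell)$; in particular $\square_n(\mathrm{id}_{\Delta[n]};\Delta[q_1],\dots,\Delta[q_n])\cong\Theta_2[n;\mathbf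 q]$. Let $\hat\square_n$ be its $(n+1)$-ary Leibniz construction, sending a tuple of maps $(X_i^0\to X_i^1)_{0\le i\le n}$ to the canonical map to $\square_n(X_0^1;X_1^1,\dots,X_n^1)$ from the colimit of the objects $\square_n(X_0^{\epsilon_0};X_1^{\epsilon_1},\dots,X_n^{\epsilon_n})$ over all $\epsilon\in\{0<1\}^{n+1}$ other than $(1,\dots,1)$. Define $$(\partial\Theta_2[n;\mathbf q]\hookrightarrow\Theta_2[n;\mathbf q])=\hat\square_n(\partial\Delta[n]\hookrightarrow\Delta[n];\ \partial\Delta[q_1]\hookrightarrow\Delta[q_1],\dots,\partial\Delta[q_n]\hookrightarrow\Delta[q_n]),$$ $$(\Lambda^k_h[n;\mathbf q]\hookrightarrow\Theta_2[n;\mathbf q])=\hat\square_n(\Lambda^k[n]\hookrightarrow\Delta[n];\ \partial\Delta[q_1]\hookrightarrow\Delta[q_1],\dots,\partial\Delta[q_n]\hookrightarrow\Delta[q_n]),$$ and let $\mathcal H_h$ be the set of inner horizontal horn inclusions $\Lambda^k_h[n;\mathbf q]\hookrightarrow\Theta_2[n;\mathbf q]$, $1\le k\le n-1$. Let $J$ be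 the nerve of the chaotic category on two objects, let $e:\Theta_2[0]\hookrightarrow J$ be the inclusion of one of the two objects, and let $\hat\times$ be the Leibniz construction of the cartesian product of cellular sets (the pushout-product). The horizontal equivalence extensions are the maps $e\mathbin{\hat\times}(\partial\Theta_2[n;\mathbf q]\hookrightarrow\Theta_2[n;\mathbf q])$; they form the set $\mathcal E_h$. For a set $\mathcal S$ of maps of cellular sets, let $\mathrm{cell}(\mathcal S)$ be the closure of $\mathcal S$ under transfinite composition and pushouts along arbitrary maps. **Lemma.** For every object $[n;\mathbf q]\neq[0]$ of $\Theta_2$, the horizontal equivalence extension $$(e:\Theta_2[0]\hookrightarrow J)\mathbin{\hat\times}(\partial\Theta_2[n;\mathbf q]\hookrightarrow\Theta_2[n;\mathbf q])$$ lies in $\mathrm{cell}(\mathcal H_h)$. Consequently $\mathrm{cell}(\mathcal H_h\cup\mathcal E_h)=\mathrm{cell}(\mathcal H_h\cup\{e\})$, i.e. among the horizontal equivalence extensions only the single map $e$ is needed. -/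

import Mathlib

open CategoryTheory Limits Opposite Simplicial MonoidalCategory

noncomputable section

/-! ### Joyal's 2-cell category `Θ₂` -/

/-- An object `[n; q₁, …, qₙ]` of `Θ₂`; the entry `q i` is `q_{i+1}` in one-based numbering. -/
@[ext]
structure Theta2 : Type where
  n : ℕ
  q : Fin n → ℕ

namespace Theta2

/-- The object `[0]`. -/
def zero : Theta2 := ⟨0, Fin.elim0⟩

/-- `Covers α l k` says `α(ℓ-1) < κ ≤ α(ℓ)` for the one-based indices `ℓ = l + 1`, `κ = k + 1`. -/
def Covers {m n : ℕ} (α : ⦋m⦌ ⟶ ⦋n⦌) (l : Fin m) (k : Fin n) : Prop :=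
  ((α.toOrderHom l.castSucc : Fin (n + 1)) : ℕ) ≤ k ∧
    (k : ℕ) + 1 ≤ ((α.toOrderHom l.succ : Fin (n + 1)) : ℕ)

lemma Covers.unique {m n : ℕ} {α : ⦋m⦌ ⟶ ⦋n⦌} {l l' : Fin m} {k : Fin n}
    (h : Covers α l k) (h' : Covers α l' k) : l = l' := by
  by_contra hne
  rcases lt_or_gt_of_ne hne with hlt | hlt
  · have h1 : l.succ ≤ l'.castSucc := by
      simp only [Fin.le_def, Fin.val_succ, Fin.val_castSucc]
      exact hlt
    have h2 := Fin.le_def.1 (α.toOrderHom.monotone h1)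
    have h3 := h.2
    have h4 := h'.1
    omega
  · have h1 : l'.succ ≤ l.castSucc := by
      simp only [Fin.le_def, Fin.val_succ, Fin.val_castSucc]
      exact hlt
    have h2 := Fin.le_def.1 (α.toOrderHom.monotone h1)
    have h3 := h'.2
    have h4 := h.1
    omega

lemma covers_id {n : ℕ} {l k : Fin n} : Covers (𝟙 ⦋n⦌) l k ↔ l = k := by
  simp only [Covers, SimplexCategory.id_toOrderHom, OrderHom.id_coe, id_eq, Fin.val_castSucc,
    Fin.val_succ]
  omega

lemma exists_covers_of_bounds {m n : ℕ} (β : ⦋m⦌ ⟶ ⦋n⦌) (k : Fin n) (a b : Fin (m + 1))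
    (ha : ((β.toOrderHom a : Fin (n + 1)) : ℕ) ≤ k)
    (hb : (k : ℕ) + 1 ≤ ((β.toOrderHom b : Fin (n + 1)) : ℕ)) :
    ∃ j : Fin m, Covers β j k ∧ (a : ℕ) ≤ j ∧ (j : ℕ) + 1 ≤ b := by
  classical
  let P : ℕ → Prop := fun i ↦ ∃ h : i < m + 1,
    (k : ℕ) + 1 ≤ ((β.toOrderHom (⟨i, h⟩ : Fin (m + 1)) : Fin (n + 1)) : ℕ)
  have hP : ∃ i, P i := ⟨b, b.2, hb⟩
  obtain ⟨hi, hi'⟩ := Nat.find_spec hP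
  have hlt : (a : ℕ) < Nat.find hP := by
    by_contra hle
    have hle' : (⟨Nat.find hP, hi⟩ : Fin (m + 1)) ≤ a := Fin.le_def.2 (not_lt.1 hle)
    have := Fin.le_def.1 (β.toOrderHom.monotone hle')
    omega
  have hpred : ¬ P (Nat.find hP - 1) := Nat.find_min hP (by omega)
  have hleb : Nat.find hP ≤ b := Nat.find_min' hP ⟨b.2, hb⟩
  refine ⟨⟨Nat.find hP - 1, by omega⟩, ⟨?_, ?_⟩, ?_, ?_⟩
  · by_contra hc
    exact hpred ⟨by omega, by
      have : (Fin.castSucc (⟨Nat.find hP - 1, by omega⟩ : Fin m)) =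
        (⟨Nat.find hP - 1, by omega⟩ : Fin (m + 1)) := rfl
      rw [this] at hc
      omega⟩
  · have : (Fin.succ (⟨Nat.find hP - 1, by omega⟩ : Fin m)) =
        (⟨Nat.find hP, hi⟩ : Fin (m + 1)) := by
      apply Fin.ext
      simp only [Fin.val_succ]
      omega
    rw [this]
    exact hi'
  · simp only
    omega
  · simp only
    omega

lemma covers_comp {m n r : ℕ} {α : ⦋m⦌ ⟶ ⦋n⦌} {β : ⦋n⦌ ⟶ ⦋r⦌} {l : Fin m} {k : Fin r} :
    Covers (α ≫ β) l k ↔ ∃ j, Covers α l j ∧ Covers β j k := by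
  constructor
  · rintro ⟨h1, h2⟩
    obtain ⟨j, hj, h3, h4⟩ := exists_covers_of_bounds β k (α.toOrderHom l.castSucc)
      (α.toOrderHom l.succ) h1 h2
    exact ⟨j, ⟨h3, h4⟩, hj⟩
  · rintro ⟨j, ⟨h1, h2⟩, h3, h4⟩
    have h5 : (α.toOrderHom l.castSucc : Fin (n + 1)) ≤ j.castSucc := h1
    have h6 : j.succ ≤ (α.toOrderHom l.succ : Fin (n + 1)) := by
      rw [Fin.le_def]; simpa using h2
    have h7 := Fin.le_def.1 (β.toOrderHom.monotone h5)
    have h8 := Fin.le_def.1 (β.toOrderHom.monotone h6)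
    exact ⟨h7.trans h3, h4.trans h8⟩

/-- The unique intermediate index in a composite. -/
def mid {m n r : ℕ} {α : ⦋m⦌ ⟶ ⦋n⦌} {β : ⦋n⦌ ⟶ ⦋r⦌} {l : Fin m} {k : Fin r}
    (h : Covers (α ≫ β) l k) : Fin n :=
  (covers_comp.1 h).choose

lemma mid_left {m n r : ℕ} {α : ⦋m⦌ ⟶ ⦋n⦌} {β : ⦋n⦌ ⟶ ⦋r⦌} {l : Fin m} {k : Fin r}
    (h : Covers (α ≫ β) l k) : Covers α l (mid h) :=
  (covers_comp.1 h).choose_spec.1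

lemma mid_right {m n r : ℕ} {α : ⦋m⦌ ⟶ ⦋n⦌} {β : ⦋n⦌ ⟶ ⦋r⦌} {l : Fin m} {k : Fin r}
    (h : Covers (α ≫ β) l k) : Covers β (mid h) k :=
  (covers_comp.1 h).choose_spec.2

/-- A cellular operator `[α; α_k] : [m; p] ⟶ [n; q]`: a simplicial operator `α : [m] ⟶ [n]` and
simplicial operators `α_k : [p_ℓ] ⟶ [q_k]` whenever `α(ℓ-1) < k ≤ α(ℓ)`. -/
structure Hom (X Y : Theta2) : Type where
  base : ⦋X.n⦌ ⟶ ⦋Y.n⦌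
  vert : ∀ (l : Fin X.n) (k : Fin Y.n), Covers base l k → (⦋X.q l⦌ ⟶ ⦋Y.q k⦌)

lemma Hom.ext' {X Y : Theta2} {f g : Hom X Y} (h : f.base = g.base)
    (h' : ∀ l k hf hg, f.vert l k hf = g.vert l k hg) : f = g := by
  obtain ⟨a, u⟩ := f
  obtain ⟨b, v⟩ := g
  obtain rfl : a = b := h
  congr
  funext l k hc
  exact h' l k hc hc

/-- The identity cellular operator. -/
def Hom.id (X : Theta2) : Hom X X where
  base := 𝟙 _
  vert l k h := eqToHom (by rw [covers_id.1 h])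

/-- Composition of cellular operators, componentwise along the unique intermediate index. -/
def Hom.comp {X Y Z : Theta2} (f : Hom X Y) (g : Hom Y Z) : Hom X Z where
  base := f.base ≫ g.base
  vert l k h := f.vert l (mid h) (mid_left h) ≫ g.vert (mid h) k (mid_right h)

lemma Hom.comp_vert {X Y Z : Theta2} (f : Hom X Y) (g : Hom Y Z) {l : Fin X.n} {k : Fin Z.n}
    (j : Fin Y.n) (hf : Covers f.base l j) (hg : Covers g.base j k)
    (h : Covers (f.comp g).base l k) :
    (f.comp g).vert l k h = f.vert l j hf ≫ g.vert j k hg := by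
  obtain rfl : mid (α := f.base) (β := g.base) h = j := (mid_right h).unique hg
  rfl

lemma Hom.id_vert (X : Theta2) (l : Fin X.n) (h : Covers (Hom.id X).base l l) :
    (Hom.id X).vert l l h = 𝟙 _ := rfl

instance : Category Theta2 where
  Hom := Hom
  id := Hom.id
  comp := Hom.comp
  id_comp {X Y} f := Hom.ext' (Category.id_comp _) (fun l k h h' ↦ by
    have hl : Covers (Hom.id X).base l l := covers_id.2 rfl
    rw [Hom.comp_vert (Hom.id X) f l hl h', Hom.id_vert, Category.id_comp])
  comp_id {X Y} f := Hom.ext' (Category.comp_id _) (fun l k h h' ↦ by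
    have hk : Covers (Hom.id Y).base k k := covers_id.2 rfl
    rw [Hom.comp_vert f (Hom.id Y) k h' hk, Hom.id_vert, Category.comp_id])
  assoc {X Y Z W} f g e := Hom.ext' (Category.assoc _ _ _) (fun l k h h' ↦ by
    obtain ⟨i, hi, hi'⟩ := covers_comp.1 (show Covers ((f.base ≫ g.base) ≫ e.base) l k from h)
    obtain ⟨j, hj, hj'⟩ := covers_comp.1 hi
    have hfg : Covers (f.comp g).base l i := hi
    have hge : Covers (g.comp e).base j k := covers_comp.2 ⟨i, hj', hi'⟩
    rw [Hom.comp_vert (f.comp g) e i hfg hi', Hom.comp_vert f g j hj hj',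
      Hom.comp_vert f (g.comp e) j hj hge, Hom.comp_vert g e i hj' hi', Category.assoc])

lemma comp_base {X Y Z : Theta2} (f : X ⟶ Y) (g : Y ⟶ Z) :
    Hom.base (f ≫ g) = Hom.base f ≫ Hom.base g := rfl

lemma comp_vert {X Y Z : Theta2} (f : X ⟶ Y) (g : Y ⟶ Z) {l : Fin X.n} {k : Fin Z.n}
    (j : Fin Y.n) (hf : Covers (Hom.base f) l j) (hg : Covers (Hom.base g) j k)
    (h : Covers (Hom.base (f ≫ g)) l k) :
    Hom.vert (f ≫ g) l k h = Hom.vert f l j hf ≫ Hom.vert g j k hg :=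
  Hom.comp_vert f g j hf hg h

/-- The functor `Θ₂ ⥤ Δ` sending `[α; α_k]` to `α`. -/
def toSimplex : Theta2 ⥤ SimplexCategory where
  obj X := ⦋X.n⦌
  map f := f.base
  map_id _ := rfl
  map_comp _ _ := rfl

end Theta2

/-- Cellular sets, i.e. presheaves of sets on `Θ₂`. -/
abbrev CellularSet : Type 1 := Theta2ᵒᵖ ⥤ Type

/-- The representable cellular set `Θ₂[n; q]`. -/
abbrev cellRep (θ : Theta2) : CellularSet := yoneda.obj θ

/-- The full embedding of simplicial sets into cellular sets induced by `Θ₂ ⥤ Δ`. -/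
abbrev simplicialToCellular : SSet.{0} ⥤ CellularSet :=
  (Functor.whiskeringLeft _ _ _).obj Theta2.toSimplex.op

/-! ### The functors `□ₙ` -/

namespace Box

open Theta2

variable {n : ℕ}

/-- The simplicial operator `[m] ⟶ [n]` underlying a simplex of a simplicial set over `Δ[n]`. -/
abbrev operator (X : Over (Δ[n] : SSet.{0})) {m : ℕ} (w : X.left.obj (op ⦋m⦌)) :
    ⦋m⦌ ⟶ ⦋n⦌ :=
  SSet.stdSimplex.objEquiv (X.hom.app _ w)

/-- An `[m; p]`-cell of `□ₙ(X; S₁, …, Sₙ)`, for `X` over `Δ[n]`: an `m`-simplex `w` of `X`, with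
underlying operator `α : [m] ⟶ [n]`, and for each `1 ≤ ℓ ≤ m` a map from `Δ[p_ℓ]` to the product
of the `S_k` over `α(ℓ-1) < k ≤ α(ℓ)`, i.e. a `p_ℓ`-simplex of each of these `S_k`. -/
structure Cell (X : Over (Δ[n] : SSet.{0})) (S : Fin n → SSet.{0}) (θ : Theta2) : Type where
  w : X.left.obj (op ⦋θ.n⦌)
  x : ∀ (l : Fin θ.n) (k : Fin n), Covers (operator X w) l k → (S k).obj (op ⦋θ.q l⦌)

lemma Cell.ext' {X : Over (Δ[n] : SSet.{0})} {S : Fin n → SSet.{0}} {θ : Theta2}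
    {c d : Cell X S θ} (h : c.w = d.w) (h' : ∀ l k hc hd, c.x l k hc = d.x l k hd) : c = d := by
  obtain ⟨a, u⟩ := c
  obtain ⟨b, v⟩ := d
  obtain rfl : a = b := h
  congr
  funext l k hc
  exact h' l k hc hc

lemma operator_map (X : Over (Δ[n] : SSet.{0})) {m m' : ℕ} (w : X.left.obj (op ⦋m⦌))
    (β : ⦋m'⦌ ⟶ ⦋m⦌) : operator X (X.left.map β.op w) = β ≫ operator X w := by
  have := congr_arg SSet.stdSimplex.objEquiv (NatTrans.naturality_apply X.hom β.op w)
  exact this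

lemma operator_hom {X Y : Over (Δ[n] : SSet.{0})} (f : X ⟶ Y) {m : ℕ}
    (w : X.left.obj (op ⦋m⦌)) : operator Y (f.left.app _ w) = operator X w := by
  have := NatTrans.congr_app (Over.w f) (op ⦋m⦌)
  have := ConcreteCategory.congr_hom this w
  exact congr_arg SSet.stdSimplex.objEquiv this

/-- Action of a cellular operator on cells. -/
def Cell.act {X : Over (Δ[n] : SSet.{0})} {S : Fin n → SSet.{0}} {θ θ' : Theta2}
    (c : Cell X S θ) (f : θ' ⟶ θ) : Cell X S θ' where
  w := X.left.map (Hom.base f).op c.w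
  x l k h :=
    have h' : Covers (Hom.base f ≫ operator X c.w) l k := operator_map X c.w (Hom.base f) ▸ h
    (S k).map (Hom.vert f l (mid h') (mid_left h')).op (c.x (mid h') k (mid_right h'))

lemma Cell.act_x {X : Over (Δ[n] : SSet.{0})} {S : Fin n → SSet.{0}} {θ θ' : Theta2}
    (c : Cell X S θ) (f : θ' ⟶ θ) {l : Fin θ'.n} {k : Fin n} (j : Fin θ.n)
    (hf : Covers (Hom.base f) l j) (hc : Covers (operator X c.w) j k)
    (h : Covers (operator X (c.act f).w) l k) :
    (c.act f).x l k h = (S k).map (Hom.vert f l j hf).op (c.x j k hc) := by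
  have h' : Covers (Hom.base f ≫ operator X c.w) l k := operator_map X c.w (Hom.base f) ▸ h
  obtain rfl : mid h' = j := (mid_right h').unique hc
  rfl

lemma Cell.act_id {X : Over (Δ[n] : SSet.{0})} {S : Fin n → SSet.{0}} {θ : Theta2}
    (c : Cell X S θ) : c.act (𝟙 θ) = c := by
  refine Cell.ext' ?_ ?_
  · exact Functor.map_id_apply X.left _ c.w
  · intro l k h h'
    rw [Cell.act_x c (𝟙 θ) l (covers_id.2 rfl) h']
    have hv : Hom.vert (𝟙 θ) l l (covers_id.2 rfl) = 𝟙 _ := rfl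
    rw [hv]
    exact Functor.map_id_apply (S k) _ _

lemma Cell.act_act {X : Over (Δ[n] : SSet.{0})} {S : Fin n → SSet.{0}} {θ θ' θ'' : Theta2}
    (c : Cell X S θ) (f : θ' ⟶ θ) (g : θ'' ⟶ θ') : c.act (g ≫ f) = (c.act f).act g := by
  refine Cell.ext' ?_ ?_
  · exact Functor.map_comp_apply X.left (Hom.base f).op (Hom.base g).op c.w
  · intro l k h h'
    have h₁ : Covers (Hom.base g ≫ operator X (c.act f).w) l k := operator_map X _ (Hom.base g) ▸ h'
    obtain ⟨i, hi, hi'⟩ := covers_comp.1 h₁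
    have h₂ : Covers (Hom.base f ≫ operator X c.w) i k := operator_map X _ (Hom.base f) ▸ hi'
    obtain ⟨j, hj, hj'⟩ := covers_comp.1 h₂
    have h₃ : Covers (Hom.base (g ≫ f)) l j := covers_comp.2 ⟨i, hi, hj⟩
    rw [Cell.act_x c (g ≫ f) j h₃ hj', Cell.act_x (c.act f) g i hi hi',
      Cell.act_x c f j hj hj', comp_vert g f i hi hj h₃]
    exact Functor.map_comp_apply (S k) _ _ _

/-- The cellular set `□ₙ(X; S₁, …, Sₙ)`. -/
def obj (X : Over (Δ[n] : SSet.{0})) (S : Fin n → SSet.{0}) : CellularSet where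
  obj θ := Cell X S θ.unop
  map f := ↾(fun c ↦ c.act f.unop)
  map_id θ := by
    ext c
    exact c.act_id
  map_comp f g := by
    ext c
    exact c.act_act f.unop g.unop

/-- Functoriality of cells in all the variables. -/
def Cell.map {X Y : Over (Δ[n] : SSet.{0})} {S T : Fin n → SSet.{0}} {θ : Theta2}
    (f : X ⟶ Y) (g : ∀ k, S k ⟶ T k) (c : Cell X S θ) : Cell Y T θ where
  w := f.left.app _ c.w
  x l k h := (g k).app _ (c.x l k (operator_hom f c.w ▸ h))

/-- The functor `□ₙ : (simplicial sets over Δ[n]) × (simplicial sets)ⁿ ⥤ (cellular sets)`. -/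
def functor (n : ℕ) : Over (Δ[n] : SSet.{0}) × (Fin n → SSet.{0}) ⥤ CellularSet where
  obj A := obj A.1 A.2
  map {A B} φ :=
    { app := fun θ ↦ ↾(fun c ↦ c.map φ.1 φ.2)
      naturality := by
        intro θ θ' f
        ext c
        refine Cell.ext' ?_ ?_
        · exact NatTrans.naturality_apply φ.1.left (Hom.base f.unop).op c.w
        · intro l k h h'
          have h₁ : Covers (Hom.base f.unop ≫ operator A.1 c.w) l k := by
            rw [← operator_map, ← operator_hom φ.1]
            exact h
          obtain ⟨j, hj, hj'⟩ := covers_comp.1 h₁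
          have h₂ : Covers (operator B.1 (c.map φ.1 φ.2).w) j k := by
            have := operator_hom φ.1 c.w
            exact this ▸ hj'
          have h₃ : Covers (operator A.1 (c.act f.unop).w) l k := by
            have := operator_map A.1 c.w (Hom.base f.unop)
            exact this ▸ h₁
          refine Eq.trans ?_ (Cell.act_x (c.map φ.1 φ.2) f.unop j hj h₂ h').symm
          change (φ.2 k).app _ ((c.act f.unop).x l k h₃) = _
          rw [Cell.act_x c f.unop j hj hj' h₃]
          exact NatTrans.naturality_apply (φ.2 k) _ _ }
  map_id A := by
    ext θ c
    rfl
  map_comp φ ψ := by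
    ext θ c
    rfl

end Box

/-! ### The Leibniz construction -/

/-- The canonical map from the colimit of the restriction of `G` to the non-top elements of `P`
into the value of `G` at the top. For `P = {0 < 1}ⁿ` and `G (ε) = F (X₁^{ε₁}, …, Xₙ^{εₙ})` this
is the `n`-ary Leibniz construction of `F` applied to the maps `X_i⁰ ⟶ X_i¹`. -/
def puncturedColimitMap {P : Type} [PartialOrder P] [OrderTop P] {D : Type*} [Category* D]
    (G : P ⥤ D) [HasColimit ((Subtype.mono_coe (fun ε : P ↦ ε ≠ ⊤)).functor ⋙ G)] :
    colimit ((Subtype.mono_coe (fun ε : P ↦ ε ≠ ⊤)).functor ⋙ G) ⟶ G.obj ⊤ :=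
  colimit.desc ((Subtype.mono_coe (fun ε : P ↦ ε ≠ ⊤)).functor ⋙ G)
    { pt := G.obj ⊤
      ι :=
        { app := fun ε ↦ G.map (homOfLE le_top)
          naturality := by
            intro ε ε' f
            exact (G.map_comp _ _).symm.trans (Category.comp_id _).symm } }

/-- The poset `{0 < 1}^{n+1}`, the first coordinate being singled out. -/
def Cube (n : ℕ) : Type := Fin 2 × (Fin n → Fin 2)

instance (n : ℕ) : PartialOrder (Cube n) := inferInstanceAs (PartialOrder (Fin 2 × (Fin n → Fin 2)))

instance (n : ℕ) : OrderTop (Cube n) := inferInstanceAs (OrderTop (Fin 2 × (Fin n → Fin 2)))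

namespace Box

/-- The cube `ε ↦ □ₙ(X₀^{ε₀}; X₁^{ε₁}, …, Xₙ^{εₙ})` for `f : X₀⁰ ⟶ X₀¹` over `Δ[n]` and
`g i : X_i⁰ ⟶ X_i¹`. -/
def cube {n : ℕ} {X Y : Over (Δ[n] : SSet.{0})} (f : X ⟶ Y) {S T : Fin n → SSet.{0}}
    (g : ∀ i, S i ⟶ T i) : Cube n ⥤ CellularSet where
  obj ε := (functor n).obj
    ((ComposableArrows.mk₁ f).obj ε.1, fun i ↦ (ComposableArrows.mk₁ (g i)).obj (ε.2 i))
  map h := (functor n).map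
    ((ComposableArrows.mk₁ f).map (homOfLE (leOfHom h).1),
      fun i ↦ (ComposableArrows.mk₁ (g i)).map (homOfLE ((leOfHom h).2 i)))
  map_id ε := by
    rw [← (functor n).map_id]
    congr 1
    apply Prod.ext
    · exact (ComposableArrows.mk₁ f).map_id _
    · funext i
      exact (ComposableArrows.mk₁ (g i)).map_id _
  map_comp h h' := by
    rw [← (functor n).map_comp]
    congr 1
    apply Prod.ext
    · exact (ComposableArrows.mk₁ f).map_comp (homOfLE (leOfHom h).1) (homOfLE (leOfHom h').1)
    · funext i
      exact (ComposableArrows.mk₁ (g i)).map_comp (homOfLE ((leOfHom h).2 i))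
        (homOfLE ((leOfHom h').2 i))

/-- The domain of the Leibniz box product `□̂ₙ(f; g₁, …, gₙ)`. -/
def leibnizDomain {n : ℕ} {X Y : Over (Δ[n] : SSet.{0})} (f : X ⟶ Y) {S T : Fin n → SSet.{0}}
    (g : ∀ i, S i ⟶ T i) : CellularSet :=
  colimit ((Subtype.mono_coe (fun ε : Cube n ↦ ε ≠ ⊤)).functor ⋙ cube f g)

/-- The Leibniz box product `□̂ₙ(f; g₁, …, gₙ)`. -/
def leibniz {n : ℕ} {X Y : Over (Δ[n] : SSet.{0})} (f : X ⟶ Y) {S T : Fin n → SSet.{0}}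
    (g : ∀ i, S i ⟶ T i) : leibnizDomain f g ⟶ (functor n).obj (Y, T) :=
  puncturedColimitMap (cube f g)

open Theta2 in
/-- The canonical isomorphism `□ₙ(id; Δ[q₁], …, Δ[qₙ]) ≅ Θ₂[n; q]`. -/
def repIso (θ : Theta2) :
    (functor θ.n).obj (Over.mk (𝟙 (Δ[θ.n] : SSet.{0})), fun i ↦ Δ[θ.q i]) ≅ cellRep θ :=
  NatIso.ofComponents
    (fun T ↦ Equiv.toIso
      { toFun := fun c ↦ (show Hom T.unop θ from
          { base := SSet.stdSimplex.objEquiv c.w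
            vert := fun l k h ↦ SSet.stdSimplex.objEquiv (c.x l k h) })
        invFun := fun f ↦
          { w := SSet.stdSimplex.objEquiv.symm (Hom.base f)
            x := fun l k h ↦ SSet.stdSimplex.objEquiv.symm (Hom.vert f l k h) }
        left_inv := fun _ ↦ rfl
        right_inv := fun _ ↦ rfl })
    (by
      intro T T' f
      ext c
      rfl)

end Box

/-! ### Boundaries, inner horizontal horns, equivalence extensions -/

/-- A simplicial subset of `Δ[n]` included in `Δ[n]`, as a map over `Δ[n]`. -/
abbrev overInclusion {n : ℕ} (A : (Δ[n] : SSet.{0}).Subcomplex) :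
    Over.mk A.ι ⟶ Over.mk (𝟙 (Δ[n] : SSet.{0})) :=
  Over.homMk A.ι

/-- The cellular set `∂Θ₂[n; q]`. -/
def cellBoundary (θ : Theta2) : CellularSet :=
  Box.leibnizDomain (overInclusion ∂Δ[θ.n]) (fun i ↦ (SSet.boundary.{0} (θ.q i)).ι)

/-- The boundary inclusion `∂Θ₂[n; q] ⟶ Θ₂[n; q]`, i.e. the Leibniz box product
`□̂ₙ(∂Δ[n] ⟶ Δ[n]; ∂Δ[q₁] ⟶ Δ[q₁], …, ∂Δ[qₙ] ⟶ Δ[qₙ])`. -/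
def boundaryInclusion (θ : Theta2) : cellBoundary θ ⟶ cellRep θ :=
  Box.leibniz (overInclusion ∂Δ[θ.n]) (fun i ↦ (SSet.boundary.{0} (θ.q i)).ι) ≫
    (Box.repIso θ).hom

/-- The cellular set `Λ_h^k[n; q]`. -/
def horizontalHorn (θ : Theta2) (k : Fin (θ.n + 1)) : CellularSet :=
  Box.leibnizDomain (overInclusion (SSet.horn θ.n k)) (fun i ↦ (SSet.boundary.{0} (θ.q i)).ι)

/-- The `k`-th horizontal horn inclusion `Λ_h^k[n; q] ⟶ Θ₂[n; q]`, i.e. the Leibniz box product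
`□̂ₙ(Λ^k[n] ⟶ Δ[n]; ∂Δ[q₁] ⟶ Δ[q₁], …, ∂Δ[qₙ] ⟶ Δ[qₙ])`. -/
def horizontalHornInclusion (θ : Theta2) (k : Fin (θ.n + 1)) :
    horizontalHorn θ k ⟶ cellRep θ :=
  Box.leibniz (overInclusion (SSet.horn θ.n k)) (fun i ↦ (SSet.boundary.{0} (θ.q i)).ι) ≫
    (Box.repIso θ).hom

/-- The set `H_h` of inner horizontal horn inclusions, i.e. of the maps
`Λ_h^k[n; q] ⟶ Θ₂[n; q]` with `1 ≤ k ≤ n - 1`. -/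
def innerHorizontalHorns : MorphismProperty CellularSet :=
  .ofHoms (fun a : {a : Σ θ : Theta2, Fin (θ.n + 1) // 0 < a.2 ∧ a.2 < Fin.last a.1.n} ↦
    horizontalHornInclusion a.1.1 a.1.2)

/-- The nerve `J` of the chaotic category on two objects, as a cellular set. -/
abbrev cellJ : CellularSet := simplicialToCellular.obj SSet.coherentIso.{0}

/-- The map `e : Θ₂[0] ⟶ J` picking out one of the two objects. -/
def eMap : cellRep Theta2.zero ⟶ cellJ :=
  yonedaEquiv.symm (SSet.coherentIso.x₀.{0} : SSet.coherentIso.{0} _⦋0⦌)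

/-- The horizontal equivalence extension `e ×̂ (∂Θ₂[n; q] ⟶ Θ₂[n; q])`, where `×̂` is the Leibniz
construction of the cartesian product (pushout-product). -/
def horizontalEquivalenceExtension (θ : Theta2) : Arrow CellularSet :=
  (Arrow.pushoutProduct.obj (Arrow.mk eMap)).obj (Arrow.mk (boundaryInclusion θ))

/-- The set `E_h` of horizontal equivalence extensions. -/
def horizontalEquivalenceExtensions : MorphismProperty CellularSet :=
  .ofHoms (fun θ : Theta2 ↦ (horizontalEquivalenceExtension θ).hom)

/-- `cell(S)`: the closure of `S` under transfinite composition and pushouts along arbitrary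
maps. -/
def cellClosure {C : Type 1} [Category.{0} C] (S : MorphismProperty C) : MorphismProperty C :=
  fun _ _ f ↦ ∀ W : MorphismProperty C, S ≤ W → W.IsStableUnderCobaseChange →
    MorphismProperty.IsStableUnderTransfiniteComposition.{0} W → W f

end

/-! A cell of J × Θ₂[n; q] is a 0/1-labelling of the vertices of a cellular operator f into [n; q]
(`cylinder`); it traces a path in {0,1} × [n]. The image of the extension, `cylinderEnd`, consists
of the cells labelled 0 throughout and those with f in the boundary. The other cells are added fibre
by fibre: stage j + 1 of `fibreFiltration` adds those that take the label 1 over j and only the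
label 0 above j.

Fix j > 0. The new nondegenerate cells come in pairs: a path entering the fibre over j at (0, j) is
paired with its face opposite that vertex, which enters at (1, j). The vertex (0, j), the pivot, is
interior: a lower fibre precedes it and (1, j) follows it. For j = 0 nothing lies before the fibre,
so (0, 0) is inserted where the path leaves the fibre, after (1, 0); it is interior because n > 0.
Thus each pair can be attached along an inner horizontal horn.

The order of attachment is governed by a weighted length `Path.len`: a repetition counts 0, a step
from which (0, j) has been omitted (`Vertex.Jump`) counts 2, any other step 1. Omitting the pivot
preserves the length of a reduced path, while missing any other vertex lowers it
(`IsReduced.len_comp_eq`, `IsReduced.len_comp_lt`). Every admissible path factors through a unique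
reduced one (`IsAdmissible.exists_isReduced`, `IsReduced.unique`), so each step of
`lengthFiltration` is a finite succession of pushouts of horns, one per reduced path
(`lengthFiltration_mem`). The vertical entries cause no trouble: a step of a reduced path crosses at
most one entry of q, which becomes its vertical entry, and otherwise has entry 0.

For the last claim, ∂Θ₂[0] is empty, so the extension indexed by [0] is e itself (`eMapIso`). -/

noncomputable section

/-! ### Attaching cells to subpresheaves. -/

namespace CategoryTheory.Subfunctor

variable {C : Type} [Category.{0} C] {X Y : C ⥤ Type}

/-- A map of presheaves that is injective with range `A` is isomorphic to the inclusion of `A`. -/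
def arrowIsoOfInjective (g : Y ⟶ X) (A : Subfunctor X)
    (hg : ∀ U, Function.Injective (g.app U)) (hA : ∀ U x, x ∈ A.obj U ↔ ∃ y, g.app U y = x) :
    Arrow.mk g ≅ Arrow.mk A.ι :=
  have hr : range g ≤ A := by
    rintro U _ ⟨y, rfl⟩
    exact (hA U _).2 ⟨y, rfl⟩
  haveI : IsIso (lift g hr) := by
    refine @NatIso.isIso_of_isIso_app _ _ _ _ _ _ _ fun U ↦ ?_
    rw [isIso_iff_bijective]
    refine ⟨fun y y' h ↦ hg U (congr_arg Subtype.val h), fun ⟨x, hx⟩ ↦ ?_⟩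
    obtain ⟨y, rfl⟩ := (hA U x).1 hx
    exact ⟨y, rfl⟩
  Arrow.isoMk (asIso (lift g hr)) (Iso.refl _) rfl

/-- The square attaching `Y` to `A` along `H`. -/
theorem isPushout_of_attach {A B : Subfunctor X} (hAB : A ≤ B) (f : Y ⟶ X) (H : Subfunctor Y)
    (hf : ∀ U y, f.app U y ∈ B.obj U) (hH : ∀ U y, f.app U y ∈ A.obj U ↔ y ∈ H.obj U)
    (hB : ∀ U, ∀ x ∈ B.obj U, x ∈ A.obj U ∨ ∃ y, f.app U y = x)
    (inj : ∀ U y y', y ∉ H.obj U → y' ∉ H.obj U → f.app U y = f.app U y' → y = y') :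
    IsPushout (lift (G := A) (H.ι ≫ f) (by
        rintro U _ ⟨y, rfl⟩
        exact (hH U _).2 y.2)) H.ι (homOfLe hAB)
      (lift (G := B) f (by
        rintro U _ ⟨y, rfl⟩
        exact hf U y)) where
  w := rfl
  isColimit' := ⟨evaluationJointlyReflectsColimits _ (fun U ↦ by
    refine (isColimitMapCoconePushoutCoconeEquiv _ _).symm (IsPushout.isColimit ?_)
    have : Mono (((evaluation C Type).obj U).map (homOfLe hAB)) := by
      rw [mono_iff_injective]
      intro (x : A.obj U) (y : A.obj U) h
      exact Subtype.ext (congr_arg (fun z : B.obj U ↦ z.1) h)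
    refine Types.isPushout_of_isPullback_of_mono' ?_ ?_ ?_
    · rw [Types.isPullback_iff]
      refine ⟨rfl, fun x y h ↦ Subtype.ext h.2, fun x y h ↦ ?_⟩
      have h' : x.1 = f.app U y := congr_arg Subtype.val h
      exact ⟨⟨y, (hH U y).1 (h' ▸ x.2)⟩, Subtype.ext h'.symm, rfl⟩
    · ext ⟨x, hx⟩
      refine ⟨fun _ ↦ Set.mem_univ _, fun _ ↦ ?_⟩
      obtain h | ⟨y, rfl⟩ := hB U x hx
      · exact Or.inl ⟨(⟨x, h⟩ : A.obj U), rfl⟩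
      · exact Or.inr ⟨(y : Y.obj U), rfl⟩
    · intro y y' hy hy' h
      exact inj U y y' (fun h ↦ hy ⟨(⟨y, h⟩ : H.obj U), rfl⟩)
        (fun h ↦ hy' ⟨(⟨y', h⟩ : H.obj U), rfl⟩) (congr_arg (fun z : B.obj U ↦ z.1) h))⟩

variable (W : MorphismProperty (C ⥤ Type))

theorem homOfLe_self_mem [MorphismProperty.IsStableUnderTransfiniteComposition.{0} W]
    {A B : Subfunctor X} (h : A ≤ B) (h' : B ≤ A) : W (homOfLe h) := by
  obtain rfl := le_antisymm h h'
  exact W.id_mem _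

theorem homOfLe_trans_mem [MorphismProperty.IsStableUnderTransfiniteComposition.{0} W]
    {A B D : Subfunctor X} (h : A ≤ B) (h' : B ≤ D)
    (hW : W (homOfLe h)) (hW' : W (homOfLe h')) : W (homOfLe (h.trans h')) :=
  W.comp_mem _ _ hW hW'

/-- The functor sending a subfunctor to its underlying functor. -/
@[simps]
def underlying (X : C ⥤ Type) : Subfunctor X ⥤ (C ⥤ Type) where
  obj A := A.toFunctor
  map h := homOfLe (leOfHom h)

theorem homOfLe_iSup_mem [MorphismProperty.IsStableUnderTransfiniteComposition.{0} W]
    (A : ℕ → Subfunctor X) (hA : ∀ m, A m ≤ A (m + 1))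
    (hW : ∀ m, W (homOfLe (hA m))) : W (homOfLe (le_iSup A 0)) := by
  have mono : Monotone A := monotone_nat_of_le_succ hA
  have hmem {U} {x : X.obj U} (hx : x ∈ (⨆ i, A i).obj U) : ∃ i, x ∈ (A i).obj U := by
    simpa using hx
  refine W.transfiniteCompositionsOfShape_le ℕ _ ⟨?_⟩
  refine
    { F := mono.functor ⋙ underlying X
      isoBot := Iso.refl _
      -- ℕ has no limit elements, so continuity is vacuous.
      isWellOrderContinuous := ⟨fun m hm ↦ (Order.not_isSuccLimit_of_isSuccArchimedean hm).elim⟩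
      incl := { app := fun m ↦ homOfLe (le_iSup A m) }
      isColimit := evaluationJointlyReflectsColimits _ (fun U ↦ ?_)
      fac := by ext; rfl
      map_mem := fun m _ ↦ hW m }
  refine Types.FilteredColimit.isColimitOf' _ _ ?_ ?_
  · intro (x : (⨆ i, A i).obj U)
    obtain ⟨i, hi⟩ := hmem x.2
    exact ⟨i, (⟨x.1, hi⟩ : (A i).obj U), rfl⟩
  · intro i (x : (A i).obj U) (y : (A i).obj U) h
    have : x = y := Subtype.ext (congr_arg (fun z : (⨆ i, A i).obj U ↦ z.1) h)
    exact ⟨i, 𝟙 _, by rw [this]⟩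

theorem homOfLe_mem_of_attach [W.IsStableUnderCobaseChange]
    {A B : Subfunctor X} (hAB : A ≤ B) (f : Y ⟶ X) (H : Subfunctor Y)
    (hW : W H.ι)
    (hf : ∀ U y, f.app U y ∈ B.obj U) (hH : ∀ U y, f.app U y ∈ A.obj U ↔ y ∈ H.obj U)
    (hB : ∀ U, ∀ x ∈ B.obj U, x ∈ A.obj U ∨ ∃ y, f.app U y = x)
    (inj : ∀ U y y', y ∉ H.obj U → y' ∉ H.obj U → f.app U y = f.app U y' → y = y') :
    W (homOfLe hAB) :=
  W.of_isPushout (isPushout_of_attach hAB f H hf hH hB inj) hW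

/-- Attaching a finite family of cells simultaneously. -/
theorem homOfLe_mem_of_attach_finite [W.IsStableUnderCobaseChange]
    [MorphismProperty.IsStableUnderTransfiniteComposition.{0} W]
    {ι : Type} [Finite ι] {A B : Subfunctor X} (hAB : A ≤ B)
    (Z : ι → C ⥤ Type) (f : ∀ i, Z i ⟶ X) (H : ∀ i, Subfunctor (Z i))
    (hW : ∀ i, W (H i).ι)
    (hf : ∀ i U y, (f i).app U y ∈ B.obj U)
    (hH : ∀ i U y, (f i).app U y ∈ A.obj U ↔ y ∈ (H i).obj U)
    (hB : ∀ U, ∀ x ∈ B.obj U, x ∈ A.obj U ∨ ∃ i y, (f i).app U y = x)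
    (inj : ∀ i i' U y y', y ∉ (H i).obj U → y' ∉ (H i').obj U →
      (f i).app U y = (f i').app U y' → ∃ h : i = i', h ▸ y = y') :
    W (homOfLe hAB) := by
  classical
  have := Fintype.ofFinite ι
  let A' (s : Finset ι) : Subfunctor X := A ⊔ ⨆ i ∈ s, range (f i)
  have mem_A' (s : Finset ι) (U) (x : X.obj U) : x ∈ (A' s).obj U ↔
      x ∈ A.obj U ∨ ∃ i ∈ s, ∃ y, (f i).app U y = x := by
    simp [A', range]
  have key (s : Finset ι) : W (homOfLe (show A ≤ A' s from le_sup_left)) := by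
    induction s using Finset.induction with
    | empty => exact homOfLe_self_mem W _ (by simp [A'])
    | insert a s ha ih =>
      have hle : A' s ≤ A' (insert a s) := by
        intro U x hx
        rw [mem_A'] at hx ⊢
        obtain h | ⟨i, hi, h⟩ := hx
        · exact Or.inl h
        · exact Or.inr ⟨i, Finset.mem_insert_of_mem hi, h⟩
      refine homOfLe_trans_mem W le_sup_left hle ih
        (homOfLe_mem_of_attach W hle (f a) (H a) (hW a) ?_ ?_ ?_ ?_)
      · intro U y
        exact (mem_A' _ _ _).2 (Or.inr ⟨a, Finset.mem_insert_self _ _, y, rfl⟩)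
      · intro U y
        rw [mem_A', hH]
        refine ⟨?_, Or.inl⟩
        rintro (h | ⟨i, hi, y', h⟩)
        · exact h
        -- A point of the new cell outside its `H` cannot lie in an earlier cell: its partner there
        -- would either be in that cell's `H`, hence in `A`, or be identified with it by `inj`,
        -- forcing equal indices.
        · by_contra hy
          by_cases hy' : y' ∈ (H i).obj U
          · exact hy ((hH _ _ _).1 (h ▸ (hH _ _ _).2 hy'))
          · obtain ⟨rfl, -⟩ := inj _ _ _ _ _ hy' hy h
            exact ha hi
      · intro U x hx
        rw [mem_A'] at hx ⊢
        obtain h | ⟨i, hi, h⟩ := hx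
        · exact Or.inl (Or.inl h)
        · obtain rfl | hi := Finset.mem_insert.1 hi
          · exact Or.inr h
          · exact Or.inl (Or.inr ⟨i, hi, h⟩)
      · intro U y y' hy hy' h
        obtain ⟨_, h⟩ := inj _ _ _ _ _ hy hy' h
        exact h
  have hAB' : B ≤ A' Finset.univ := by
    intro U x hx
    rw [mem_A']
    obtain h | ⟨i, h⟩ := hB U x hx
    · exact Or.inl h
    · exact Or.inr ⟨i, Finset.mem_univ _, h⟩
  have hAB'' : A' Finset.univ ≤ B := by
    intro U x hx
    rw [mem_A'] at hx
    obtain h | ⟨i, -, y, rfl⟩ := hx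
    · exact hAB _ h
    · exact hf i U y
  obtain rfl : B = A' Finset.univ := le_antisymm hAB' hAB''
  exact key _

end CategoryTheory.Subfunctor

end

noncomputable section

/-! ### Leibniz constructions as unions of subpresheaves. -/

section PuncturedColimit

variable {C : Type} [Category.{0} C] {P : Type} [PartialOrder P] [OrderTop P] (G : P ⥤ (C ⥤ Type))

theorem puncturedColimit_exists_rep (U : C)
    (x : (colimit ((Subtype.mono_coe (fun ε : P ↦ ε ≠ ⊤)).functor ⋙ G)).obj U) :
    ∃ (ε : {ε : P // ε ≠ ⊤}) (y : (G.obj ε.1).obj U),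
      (colimit.ι ((Subtype.mono_coe (fun ε : P ↦ ε ≠ ⊤)).functor ⋙ G) ε).app U y = x :=
  Types.jointly_surjective_of_isColimit
    (isColimitOfPreserves ((evaluation C Type).obj U) (colimit.isColimit _)) x

theorem puncturedColimitMap_app_ι (U : C) (ε : {ε : P // ε ≠ ⊤}) (y : (G.obj ε.1).obj U) :
    (puncturedColimitMap G).app U
      ((colimit.ι ((Subtype.mono_coe (fun ε : P ↦ ε ≠ ⊤)).functor ⋙ G) ε).app U y) =
      (G.map (homOfLE le_top)).app U y := by
  have h := colimit.ι_desc (F := (Subtype.mono_coe (fun ε : P ↦ ε ≠ ⊤)).functor ⋙ G)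
    { pt := G.obj ⊤
      ι :=
        { app := fun ε ↦ G.map (homOfLE le_top)
          naturality := by
            intro ε ε' f
            exact (G.map_comp _ _).symm.trans (Category.comp_id _).symm } } ε
  exact ConcreteCategory.congr_hom (NatTrans.congr_app h U) y

theorem puncturedColimitMap_range (U : C) (x : (G.obj ⊤).obj U) :
    (∃ y, (puncturedColimitMap G).app U y = x) ↔
      ∃ (ε : P) (_ : ε ≠ ⊤) (y : (G.obj ε).obj U), (G.map (homOfLE le_top)).app U y = x := by
  constructor
  · rintro ⟨z, rfl⟩
    obtain ⟨ε, y, rfl⟩ := puncturedColimit_exists_rep G U z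
    exact ⟨ε.1, ε.2, y, (puncturedColimitMap_app_ι G U ε y).symm⟩
  · rintro ⟨ε, hε, y, rfl⟩
    exact ⟨_, puncturedColimitMap_app_ι G U ⟨ε, hε⟩ y⟩

/-- Two representatives with the same image in `G ⊤` both come from one element at a smaller index.
That index is still not the top, so they are already identified in the colimit. -/
theorem puncturedColimitMap_injective (U : C)
    (h : ∀ (ε ε' : P) (y : (G.obj ε).obj U) (y' : (G.obj ε').obj U),
      (G.map (homOfLE le_top : ε ⟶ ⊤)).app U y = (G.map (homOfLE le_top : ε' ⟶ ⊤)).app U y' →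
      ∃ (δ : P) (h : δ ≤ ε) (h' : δ ≤ ε') (z : (G.obj δ).obj U),
        (G.map (homOfLE h)).app U z = y ∧ (G.map (homOfLE h')).app U z = y') :
    Function.Injective ((puncturedColimitMap G).app U) := by
  intro x x' hx
  obtain ⟨ε, y, rfl⟩ := puncturedColimit_exists_rep G U x
  obtain ⟨ε', y', rfl⟩ := puncturedColimit_exists_rep G U x'
  rw [puncturedColimitMap_app_ι, puncturedColimitMap_app_ι] at hx
  obtain ⟨δ, hδ, hδ', z, rfl, rfl⟩ := h _ _ _ _ hx
  have hne : δ ≠ ⊤ := fun h ↦ ε.2 (top_le_iff.1 (h ▸ hδ))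
  have e₁ := colimit.w ((Subtype.mono_coe (fun ε : P ↦ ε ≠ ⊤)).functor ⋙ G)
    (homOfLE (show (⟨δ, hne⟩ : {ε : P // ε ≠ ⊤}) ≤ ε from hδ))
  have e₂ := colimit.w ((Subtype.mono_coe (fun ε : P ↦ ε ≠ ⊤)).functor ⋙ G)
    (homOfLE (show (⟨δ, hne⟩ : {ε : P // ε ≠ ⊤}) ≤ ε' from hδ'))
  exact (ConcreteCategory.congr_hom (NatTrans.congr_app e₁ U) z).trans
    (ConcreteCategory.congr_hom (NatTrans.congr_app e₂ U) z).symm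

end PuncturedColimit

/-- In the chain {0 < 1} the meet is one of the two indices, and injectivity into the top value lets
equality be tested there. -/
theorem exists_of_map_eq_map_top (F : Fin 2 ⥤ Type)
    (hF : ∀ e : Fin 2, Function.Injective (F.map (homOfLE (Fin.le_last e) : e ⟶ Fin.last 1)))
    {e e' : Fin 2} (a : F.obj e) (b : F.obj e')
    (hab : F.map (homOfLE (Fin.le_last e) : e ⟶ Fin.last 1) a =
      F.map (homOfLE (Fin.le_last e') : e' ⟶ Fin.last 1) b) :
    ∃ c : F.obj (e ⊓ e'), F.map (homOfLE inf_le_left) c = a ∧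
      F.map (homOfLE inf_le_right) c = b := by
  have key {i j : Fin 2} (hij : i ≤ j) (x : F.obj i) :
      F.map (homOfLE (Fin.le_last j) : j ⟶ Fin.last 1) (F.map (homOfLE hij) x) =
        F.map (homOfLE (Fin.le_last i) : i ⟶ Fin.last 1) x :=
    (Functor.map_comp_apply F (homOfLE hij) (homOfLE (Fin.le_last j)) x).symm
  rcases le_total e e' with h | h
  · refine ⟨F.map (homOfLE (le_inf le_rfl h)) a, hF _ ?_, hF _ ?_⟩
    · rw [key, key]
    · rw [key, key, hab]
  · refine ⟨F.map (homOfLE (le_inf h le_rfl)) b, hF _ ?_, hF _ ?_⟩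
    · rw [key, key, hab]
    · rw [key, key]

namespace Box

open Theta2

variable {n : ℕ}

lemma Cell.w_congr {X : Over (Δ[n] : SSet.{0})} {S : Fin n → SSet.{0}} {θ : Theta2}
    {c d : Cell X S θ} (h : c = d) : c.w = d.w := by rw [h]

lemma Cell.x_congr {X : Over (Δ[n] : SSet.{0})} {S : Fin n → SSet.{0}} {θ : Theta2}
    {c d : Cell X S θ} (h : c = d) (l k hc hd) : c.x l k hc = d.x l k hd := by
  subst h
  rfl

variable {X Y : Over (Δ[n] : SSet.{0})} (f : X ⟶ Y) {S T : Fin n → SSet.{0}} (g : ∀ i, S i ⟶ T i)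

/-- The gluing criterion holds at the coordinatewise meet of the two indices: cells with the same
image descend together in each variable. -/
theorem leibniz_injective (hf : ∀ U, Function.Injective (f.left.app U))
    (hg : ∀ i U, Function.Injective ((g i).app U)) (U : Theta2ᵒᵖ) :
    Function.Injective ((leibniz f g).app U) := by
  refine puncturedColimitMap_injective (cube f g) U ?_
  intro ε ε' (c : Cell _ _ _) (c' : Cell _ _ _) h
  have hw := Cell.w_congr h
  have hx := Cell.x_congr h
  have hF (V) (e : Fin 2) : Function.Injective
      ((ComposableArrows.mk₁ f ⋙ Over.forget _ ⋙ (evaluation _ Type).obj V).map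
        (homOfLE (Fin.le_last e) : e ⟶ Fin.last 1)) := by
    fin_cases e
    · exact hf V
    · intro a b h
      exact h
  have hG (V) (i) (e : Fin 2) : Function.Injective
      ((ComposableArrows.mk₁ (g i) ⋙ (evaluation _ Type).obj V).map
        (homOfLE (Fin.le_last e) : e ⟶ Fin.last 1)) := by
    fin_cases e
    · exact hg i V
    · intro a b h
      exact Eq.trans (Eq.symm (ConcreteCategory.congr_hom (NatTrans.congr_app ((ComposableArrows.mk₁ (g i)).map_id 1) V) a)) h
  obtain ⟨w, hw₁, hw₂⟩ := exists_of_map_eq_map_top _ (hF (op ⦋U.unop.n⦌)) c.w c'.w hw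
  let δ : Cube n := (ε.1 ⊓ ε'.1, fun i ↦ ε.2 i ⊓ ε'.2 i)
  have hδ : δ ≤ ε := ⟨inf_le_left, fun i ↦ inf_le_left⟩
  have hδ' : δ ≤ ε' := ⟨inf_le_right, fun i ↦ inf_le_right⟩
  have hc (l) (k) (h : Covers (operator ((ComposableArrows.mk₁ f).obj δ.1) w) l k) :
      Covers (operator _ c.w) l k := by
    have := operator_hom ((ComposableArrows.mk₁ f).map (homOfLE hδ.1)) w
    rw [← this] at h
    rw [← hw₁]
    exact h
  have hc' (l) (k) (h : Covers (operator ((ComposableArrows.mk₁ f).obj δ.1) w) l k) :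
      Covers (operator _ c'.w) l k := by
    have := operator_hom ((ComposableArrows.mk₁ f).map (homOfLE hδ'.1)) w
    rw [← this] at h
    rw [← hw₂]
    exact h
  have key (l) (k) (h : Covers (operator ((ComposableArrows.mk₁ f).obj δ.1) w) l k) :=
    exists_of_map_eq_map_top _ (hG (op ⦋U.unop.q l⦌) k) (c.x l k (hc l k h)) (c'.x l k (hc' l k h))
      (hx l k (by
        have := operator_hom ((ComposableArrows.mk₁ f).map
          (homOfLE (Fin.le_last ε.1) : ε.1 ⟶ Fin.last 1)) c.w
        exact this.symm ▸ hc l k h) (by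
        have := operator_hom ((ComposableArrows.mk₁ f).map
          (homOfLE (Fin.le_last ε'.1) : ε'.1 ⟶ Fin.last 1)) c'.w
        exact this.symm ▸ hc' l k h))
  choose x hx₁ hx₂ using key
  exact ⟨δ, hδ, hδ', (⟨w, x⟩ : Cell _ _ _), Cell.ext' hw₁ (fun l k _ _ ↦ hx₁ l k _),
    Cell.ext' hw₂ (fun l k _ _ ↦ hx₂ l k _)⟩

/-- A non-top index has a coordinate 0 and lies below the index whose only 0 is that coordinate, so
only these n + 1 maximal indices matter. For a `k` covered by no `l` the second alternative holds
vacuously. -/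
theorem leibniz_range (U : Theta2ᵒᵖ) (c : Cell Y T U.unop) :
    (∃ d, (leibniz f g).app U d = c) ↔
      (∃ w, f.left.app _ w = c.w) ∨ ∃ k, ∀ l h, ∃ s, (g k).app _ s = c.x l k h := by
  let c' : ((cube f g).obj ⊤).obj U := by exact c
  refine (puncturedColimitMap_range (cube f g) U c').trans ⟨?_, ?_⟩
  · rintro ⟨ε, hε, d, rfl⟩
    have : ε.1 ≠ 1 ∨ ∃ k, ε.2 k ≠ 1 := by
      by_contra! h
      exact hε (Prod.ext h.1 (funext h.2))
    obtain h | ⟨k, hk⟩ := this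
    · left
      obtain ⟨e, ε₂⟩ := ε
      obtain rfl : e = 0 := by
        change e ≠ 1 at h
        omega
      exact ⟨Cell.w d, rfl⟩
    · refine Or.inr ⟨k, fun l h ↦ ?_⟩
      have key (e : Fin 2) (he : e ≠ 1) (V) (y : ((ComposableArrows.mk₁ (g k)).obj e).obj V) :
          ∃ s, (g k).app V s = ((ComposableArrows.mk₁ (g k)).map
            (homOfLE (Fin.le_last e) : e ⟶ Fin.last 1)).app V y := by
        obtain rfl : e = 0 := by omega
        exact ⟨y, rfl⟩
      exact key _ hk _ (Cell.x d l k _)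
  · rintro (⟨w, hw⟩ | ⟨k, hk⟩)
    · let δ : Cube n := (0, fun _ ↦ 1)
      have hδ : δ ≠ ⊤ := fun h ↦ absurd (congr_arg Prod.fst h) (show (0 : Fin 2) ≠ 1 by decide)
      have hc (l) (k) (h : Covers (operator X w) l k) : Covers (operator Y c.w) l k := by
        rw [← hw, operator_hom f w]
        exact h
      refine ⟨δ, hδ, (⟨w, fun l k h ↦ c.x l k (hc l k h)⟩ : Cell X T U.unop),
        Cell.ext' hw (fun l k h _ ↦ ?_)⟩
      rfl
    · classical
      let δ : Cube n := (1, fun i ↦ if i = k then 0 else 1)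
      have hδ : δ ≠ ⊤ := fun h ↦ by
        have := congr_fun (congr_arg Prod.snd h) k
        have h0 : δ.2 k = 0 := if_pos rfl
        rw [h0] at this
        exact absurd this (show (0 : Fin 2) ≠ 1 by decide)
      have key (i : Fin n) (e : Fin 2) (V) (s : (T i).obj V)
          (he : e = 0 → ∃ s', (g i).app V s' = s) :
          ∃ y : ((ComposableArrows.mk₁ (g i)).obj e).obj V,
            ((ComposableArrows.mk₁ (g i)).map
              (homOfLE (Fin.le_last e) : e ⟶ Fin.last 1)).app V y = s := by
        fin_cases e
        · exact he rfl
        · exact ⟨s, ConcreteCategory.congr_hom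
            (NatTrans.congr_app ((ComposableArrows.mk₁ (g i)).map_id 1) V) s⟩
      have key' (l) (i) (h : Covers (operator Y c.w) l i) := key i (δ.2 i) _ (c.x l i h) (by
        intro h0
        have : i = k := by
          by_contra hne
          have h1 : δ.2 i = 1 := if_neg hne
          rw [h1] at h0
          exact absurd h0 (by decide)
        subst this
        exact hk l h)
      choose y hy using key'
      have hid (V) (w : Y.left.obj V) :
          ((ComposableArrows.mk₁ f).map (𝟙 (1 : Fin 2))).left.app V w = w :=
        ConcreteCategory.congr_hom (NatTrans.congr_app
          (congr_arg CommaMorphism.left ((ComposableArrows.mk₁ f).map_id 1)) V) w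
      exact ⟨δ, hδ, (⟨c.w, y⟩ : Cell Y _ U.unop), Cell.ext' (by exact hid _ c.w)
        (fun l k _ _ ↦ hy l k _)⟩

end Box

/-! ### Boundaries and horizontal horns inside representables. -/

open Theta2

variable (θ : Theta2)

theorem leibniz_repIso_injective (A : (Δ[θ.n] : SSet.{0}).Subcomplex) (U) :
    Function.Injective ((Box.leibniz (overInclusion A) (fun i ↦ (SSet.boundary.{0} (θ.q i)).ι) ≫
      (Box.repIso θ).hom).app U) := by
  refine Function.Injective.comp (g := (Box.repIso θ).hom.app U) ?_
    (Box.leibniz_injective _ _ ?_ ?_ U)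
  · rw [← mono_iff_injective]
    infer_instance
  · intro V
    exact Subtype.val_injective
  · intro i V
    exact Subtype.val_injective

theorem leibniz_repIso_range (A : (Δ[θ.n] : SSet.{0}).Subcomplex) (U) (f : U.unop ⟶ θ) :
    (∃ d, (Box.leibniz (overInclusion A) (fun i ↦ (SSet.boundary.{0} (θ.q i)).ι) ≫
      (Box.repIso θ).hom).app U d = f) ↔ SSet.stdSimplex.objEquiv.symm (Hom.base f) ∈ A.obj _ ∨
        ∃ k, ∀ l h, ¬ Function.Surjective (Hom.vert f l k h).toOrderHom := by
  let c : Box.Cell (Over.mk (𝟙 (Δ[θ.n] : SSet.{0}))) (fun i ↦ Δ[θ.q i]) U.unop :=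
    { w := SSet.stdSimplex.objEquiv.symm (Hom.base f)
      x := fun l k h ↦ SSet.stdSimplex.objEquiv.symm (Hom.vert f l k h) }
  have hc : (Box.repIso θ).hom.app U c = f := rfl
  have hinj : Function.Injective ((Box.repIso θ).hom.app U) := by
    rw [← mono_iff_injective]
    infer_instance
  have h := Box.leibniz_range (overInclusion A) (fun i ↦ (SSet.boundary.{0} (θ.q i)).ι) U c
  have h' : (∃ d, (Box.leibniz (overInclusion A) (fun i ↦ (SSet.boundary.{0} (θ.q i)).ι) ≫
      (Box.repIso θ).hom).app U d = f) ↔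
      ∃ d, (Box.leibniz (overInclusion A) (fun i ↦ (SSet.boundary.{0} (θ.q i)).ι)).app U d = c :=
    ⟨fun ⟨d, hd⟩ ↦ ⟨d, hinj hd⟩, fun ⟨d, hd⟩ ↦ ⟨d, congr_arg ((Box.repIso θ).hom.app U) hd⟩⟩
  rw [h', h]
  refine or_congr ⟨?_, fun hw ↦ ⟨⟨_, hw⟩, rfl⟩⟩ (exists_congr fun k ↦ forall_congr' fun l ↦
    forall_congr' fun h ↦ ⟨?_, fun hs ↦ ⟨⟨_, hs⟩, rfl⟩⟩)
  · rintro ⟨w, hw⟩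
    have : w.1 = SSet.stdSimplex.objEquiv.symm (Hom.base f) := hw
    rw [← this]
    exact w.2
  · rintro ⟨s, hs⟩
    have : s.1 = SSet.stdSimplex.objEquiv.symm (Hom.vert f l k h) := hs
    have h2 : SSet.stdSimplex.objEquiv.symm (Hom.vert f l k h) ∈ (∂Δ[θ.q k] : (Δ[θ.q k] : SSet.{0}).Subcomplex).obj _ := by
      rw [← this]
      exact s.2
    exact h2

theorem mem_range_boundaryInclusion {U : Theta2ᵒᵖ} (f : U.unop ⟶ θ) :
    f ∈ (Subfunctor.range (boundaryInclusion θ)).obj U ↔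
      ¬ Function.Surjective (Hom.base f).toOrderHom ∨
        ∃ k, ∀ l h, ¬ Function.Surjective (Hom.vert f l k h).toOrderHom :=
  leibniz_repIso_range θ _ U f

theorem mem_range_horizontalHornInclusion (k : Fin (θ.n + 1)) {U : Theta2ᵒᵖ} (f : U.unop ⟶ θ) :
    f ∈ (Subfunctor.range (horizontalHornInclusion θ k)).obj U ↔
      (∃ i, i ≠ k ∧ ∀ x, (Hom.base f).toOrderHom x ≠ i) ∨
        ∃ k, ∀ l h, ¬ Function.Surjective (Hom.vert f l k h).toOrderHom := by
  refine (leibniz_repIso_range θ _ U f).trans (or_congr_left ?_)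
  rw [SSet.mem_horn_iff]
  refine (not_congr (Set.eq_univ_iff_forall)).trans ?_
  push Not
  refine exists_congr fun i ↦ ?_
  rw [Set.mem_union, not_or, Set.mem_singleton_iff, Set.mem_range, not_exists]
  exact and_comm

/-- The inclusion of a horn is the inclusion of its range. -/
def horizontalHornIso (k : Fin (θ.n + 1)) : Arrow.mk (horizontalHornInclusion θ k) ≅
    Arrow.mk (Subfunctor.range (horizontalHornInclusion θ k)).ι :=
  Subfunctor.arrowIsoOfInjective _ _ (leibniz_repIso_injective θ _) (fun _ _ ↦ Iff.rfl)

theorem range_horn_ι_mem (W : MorphismProperty CellularSet) [W.RespectsIso]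
    (hW : innerHorizontalHorns ≤ W) (k : Fin (θ.n + 1)) (h₀ : 0 < k) (h₁ : k < Fin.last θ.n) :
    W (Subfunctor.range (horizontalHornInclusion θ k)).ι := by
  refine (W.arrow_mk_iso_iff (horizontalHornIso θ k)).1 (hW _ ?_)
  exact (MorphismProperty.ofHoms_iff _ _).2 ⟨⟨⟨θ, k⟩, h₀, h₁⟩, rfl⟩

end

noncomputable section

/-! ### Pushout-products and the explicit cylinder. -/

section PushoutProduct

variable {C : Type} [Category.{0} C] {X₁ Y₁ X₂ Y₂ : C ⥤ Type} (f : X₁ ⟶ Y₁) (g : X₂ ⟶ Y₂)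

/-- The two products inside `Y₁ × Y₂` intersect exactly in `X₁ × X₂`, so their pushout is their
union. -/
theorem pushoutProduct_injective (U : C) (hf : Function.Injective (f.app U))
    (hg : Function.Injective (g.app U)) :
    Function.Injective (((Arrow.pushoutProduct.obj (Arrow.mk f)).obj (Arrow.mk g)).hom.app U) := by
  let sq := Functor.PushoutObjObj.ofHasPushout (curriedTensor (C ⥤ Type)) f g
  have hp := sq.isPushout.map ((evaluation C Type).obj U)
  have hl := NatTrans.congr_app sq.inl_ι U
  have hr := NatTrans.congr_app sq.inr_ι U
  have : Mono ((Y₁ ◁ g).app U) := by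
    rw [mono_iff_injective]
    rintro (⟨a, b⟩ : Y₁.obj U × X₂.obj U) (⟨a', b'⟩ : Y₁.obj U × X₂.obj U) h
    have h₁ : a = a' := congr_arg (fun z : Y₁.obj U × Y₂.obj U ↦ z.1) h
    have h₂ : g.app U b = g.app U b' := congr_arg (fun z : Y₁.obj U × Y₂.obj U ↦ z.2) h
    exact Prod.ext h₁ (hg h₂)
  have hpb : IsPullback ((f ▷ X₂).app U) ((X₁ ◁ g).app U) ((Y₁ ◁ g).app U) ((f ▷ Y₂).app U) := by
    rw [Types.isPullback_iff]
    refine ⟨rfl, ?_, ?_⟩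
    · rintro (⟨a, b⟩ : X₁.obj U × X₂.obj U) (⟨a', b'⟩ : X₁.obj U × X₂.obj U) ⟨h, h'⟩
      have h₁ : b = b' := congr_arg (fun z : Y₁.obj U × X₂.obj U ↦ z.2) h
      have h₂ : a = a' := congr_arg (fun z : X₁.obj U × Y₂.obj U ↦ z.1) h'
      exact Prod.ext h₂ h₁
    · rintro (⟨a, b⟩ : Y₁.obj U × X₂.obj U) (⟨a', b'⟩ : X₁.obj U × Y₂.obj U) h
      have h₁ : a = f.app U a' := congr_arg (fun z : Y₁.obj U × Y₂.obj U ↦ z.1) h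
      have h₂ : g.app U b = b' := congr_arg (fun z : Y₁.obj U × Y₂.obj U ↦ z.2) h
      exact ⟨((a', b) : X₁.obj U × X₂.obj U), Prod.ext h₁.symm rfl, Prod.ext rfl h₂⟩
  have := Types.mono_of_isPushout_of_isPullback hp hpb (k := sq.ι.app U) hl hr (by
    rintro (⟨a, b⟩ : X₁.obj U × Y₂.obj U) (⟨a', b'⟩ : X₁.obj U × Y₂.obj U) _ _ h
    have h₁ : f.app U a = f.app U a' := congr_arg (fun z : Y₁.obj U × Y₂.obj U ↦ z.1) h
    have h₂ : b = b' := congr_arg (fun z : Y₁.obj U × Y₂.obj U ↦ z.2) h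
    exact Prod.ext (hf h₁) h₂)
  exact (mono_iff_injective _).1 this

theorem pushoutProduct_range (U : C) (y₁ : Y₁.obj U) (y₂ : Y₂.obj U) :
    (∃ d, ((Arrow.pushoutProduct.obj (Arrow.mk f)).obj (Arrow.mk g)).hom.app U d =
      ((y₁, y₂) : Y₁.obj U × Y₂.obj U)) ↔ (∃ x, f.app U x = y₁) ∨ ∃ x, g.app U x = y₂ := by
  let sq := Functor.PushoutObjObj.ofHasPushout (curriedTensor (C ⥤ Type)) f g
  have hp := sq.isPushout.map ((evaluation C Type).obj U)
  have hl := ConcreteCategory.congr_hom (NatTrans.congr_app sq.inl_ι U)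
  have hr := ConcreteCategory.congr_hom (NatTrans.congr_app sq.inr_ι U)
  constructor
  · rintro ⟨d, hd⟩
    obtain ⟨z, rfl⟩ | ⟨z, rfl⟩ := Types.eq_or_eq_of_isPushout hp d
    · exact Or.inr ⟨z.2, congr_arg (fun z : Y₁.obj U × Y₂.obj U ↦ z.2) ((hl z).symm.trans hd)⟩
    · exact Or.inl ⟨z.1, congr_arg (fun z : Y₁.obj U × Y₂.obj U ↦ z.1) ((hr z).symm.trans hd)⟩
  · rintro (⟨x, rfl⟩ | ⟨x, rfl⟩)
    · exact ⟨sq.inr.app U ((x, y₂) : X₁.obj U × Y₂.obj U), hr ((x, y₂) : X₁.obj U × Y₂.obj U)⟩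
    · exact ⟨sq.inl.app U ((y₁, x) : Y₁.obj U × X₂.obj U), hl ((y₁, x) : Y₁.obj U × X₂.obj U)⟩

end PushoutProduct

open Theta2

/-- An explicit model of `J × Θ₂[n; q]`: a cell of shape `[m; p]` is a vertex labelling
`[m] → {0, 1}` together with a cellular operator `[m; p] ⟶ [n; q]`. -/
def cylinder (θ : Theta2) : CellularSet where
  obj U := (Fin (U.unop.n + 1) → Bool) × (U.unop ⟶ θ)
  map g := ↾fun c ↦ (c.1 ∘ (Hom.base g.unop).toOrderHom, g.unop ≫ c.2)

/-- The isomorphism `J × Θ₂[n; q] ≅ cylinder [n; q]`. -/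
def cylinderIso (θ : Theta2) : cellJ ⊗ cellRep θ ≅ cylinder θ :=
  NatIso.ofComponents
    (fun U ↦ Equiv.toIso (((Codiscrete.equivFun (X := ULift Bool) (n := U.unop.n)).trans
      (Equiv.arrowCongr (Equiv.refl _) Equiv.ulift)).prodCongr (Equiv.refl (U.unop ⟶ θ))))
    (by
      intro U V g
      ext c
      rfl)

/-- The unique cellular operator to `[0]`. -/
def toZero (U : Theta2) : U ⟶ Theta2.zero :=
  show Hom U Theta2.zero from
  { base := SimplexCategory.const _ _ 0
    vert := fun _ k _ ↦ Fin.elim0 k }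

lemma toZero_unique {U : Theta2} (f g : U ⟶ Theta2.zero) : f = g := by
  refine Hom.ext' ?_ (fun _ k _ _ ↦ Fin.elim0 k)
  ext x
  exact congr_arg Fin.val (Subsingleton.elim (α := Fin 1) _ _)

lemma eMap_injective (U : Theta2ᵒᵖ) : Function.Injective (eMap.app U) :=
  fun _ _ _ ↦ toZero_unique _ _

/-- The end `e × Θ₂[n; q] ∪ J × ∂Θ₂[n; q]` of the cylinder. -/
def cylinderEnd (θ : Theta2) : Subfunctor (cylinder θ) :=
  Subfunctor.range (((Arrow.pushoutProduct.obj (Arrow.mk eMap)).obj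
    (Arrow.mk (boundaryInclusion θ))).hom ≫ (cylinderIso θ).hom)

def horizontalEquivalenceExtensionIso (θ : Theta2) :
    horizontalEquivalenceExtension θ ≅ Arrow.mk (cylinderEnd θ).ι :=
  (show horizontalEquivalenceExtension θ ≅ Arrow.mk
      (((Arrow.pushoutProduct.obj (Arrow.mk eMap)).obj
        (Arrow.mk (boundaryInclusion θ))).hom ≫ (cylinderIso θ).hom) from
    Arrow.isoMk (Iso.refl _) (cylinderIso θ) (Category.id_comp _)) ≪≫
  Subfunctor.arrowIsoOfInjective _ _ (fun U ↦ by
    refine Function.Injective.comp (g := (cylinderIso θ).hom.app U) ?_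
      (pushoutProduct_injective _ _ U (eMap_injective U) (leibniz_repIso_injective θ _ U))
    rw [← mono_iff_injective]
    infer_instance) (fun _ _ ↦ Iff.rfl)

/-- A cell of `J` is an arbitrary labelling of vertices; it comes from `e` exactly when all labels
are `false`, the object picked by `e`. -/
theorem mem_cylinderEnd (θ : Theta2) {U : Theta2ᵒᵖ} (u : Fin (U.unop.n + 1) → Bool)
    (f : U.unop ⟶ θ) : (u, f) ∈ (cylinderEnd θ).obj U ↔
      (∀ x, u x = false) ∨ f ∈ (Subfunctor.range (boundaryInclusion θ)).obj U := by
  have hinj : Function.Injective ((cylinderIso θ).hom.app U) := by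
    rw [← mono_iff_injective]
    infer_instance
  let y₁ : cellJ.obj U := Codiscrete.equivFun.symm (fun x ↦ ULift.up (u x))
  have hy : (cylinderIso θ).hom.app U ((y₁, f) : cellJ.obj U × (cellRep θ).obj U) = (u, f) := rfl
  have h := pushoutProduct_range eMap (boundaryInclusion θ) U y₁ f
  have h' : (u, f) ∈ (cylinderEnd θ).obj U ↔
      ∃ d, ((Arrow.pushoutProduct.obj (Arrow.mk eMap)).obj
        (Arrow.mk (boundaryInclusion θ))).hom.app U d =
          ((y₁, f) : cellJ.obj U × (cellRep θ).obj U) :=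
    ⟨fun ⟨d, hd⟩ ↦ ⟨d, hinj hd⟩, fun ⟨d, hd⟩ ↦ ⟨d, congr_arg ((cylinderIso θ).hom.app U) hd⟩⟩
  rw [h', h]
  refine or_congr_left ⟨?_, fun hu ↦ ⟨toZero _, ?_⟩⟩
  · rintro ⟨t, ht⟩ x
    have := congr_arg (fun z ↦ (Codiscrete.equivFun z x).down) ht
    exact this.symm
  · apply Codiscrete.equivFun.injective
    funext x
    exact congr_arg ULift.up (hu x).symm

end

/-! ### Vertices, jumps and the weighted distance. -/

noncomputable section

/-- Vertices of `J × Δ[n]`. -/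
abbrev Vertex (n : ℕ) : Type := Bool × Fin (n + 1)

namespace Vertex

variable {n : ℕ} (j : Fin (n + 1))

/-- The pairs of vertices between which the vertex `(0, j)` gets inserted: the pairs entering the
`j`-th fibre at `(1, j)` if `0 < j`, and those leaving the fibre over `0` at `(1, 0)` if `j = 0`. -/
def Jump (a b : Vertex n) : Prop :=
  (0 < j ∧ a.2 < j ∧ b = (true, j)) ∨ (j = 0 ∧ a = (true, j) ∧ j < b.2)

/-- The number of steps from `a` to `b`, after insertion of the vertices `(0, j)`. -/
def dist (a b : Vertex n) : ℕ :=
  open Classical in if a = b then 0 else if Jump j a b then 2 else 1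

variable {j}

lemma Jump.lt {a b : Vertex n} (h : Jump j a b) : a.2 < b.2 := by
  rcases h with ⟨_, h, rfl⟩ | ⟨_, rfl, h⟩ <;> exact h

lemma Jump.le_left {a b : Vertex n} (h : Jump j a b) : a.2 ≤ j := by
  rcases h with ⟨_, h, rfl⟩ | ⟨_, rfl, h⟩
  · exact h.le
  · exact le_rfl

lemma Jump.le_right {a b : Vertex n} (h : Jump j a b) : j ≤ b.2 := by
  rcases h with ⟨_, h, rfl⟩ | ⟨_, rfl, h⟩
  · exact le_rfl
  · exact h.le

lemma dist_self (a : Vertex n) : dist j a a = 0 := by simp [dist]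

lemma eq_of_dist_eq_zero {a b : Vertex n} (h : dist j a b = 0) : a = b := by
  by_contra hne
  rw [dist, if_neg hne] at h
  split_ifs at h

lemma dist_le_two (a b : Vertex n) : dist j a b ≤ 2 := by
  unfold dist
  split_ifs <;> omega

lemma dist_eq_two_iff {a b : Vertex n} : dist j a b = 2 ↔ Jump j a b := by
  unfold dist
  split_ifs with h₁ h₂
  · subst h₁
    exact ⟨fun h ↦ by simp at h, fun h ↦ absurd h.lt (lt_irrefl _)⟩
  · simp [h₂]
  · simp [h₂]

lemma dist_eq_one_iff {a b : Vertex n} : dist j a b = 1 ↔ a ≠ b ∧ ¬ Jump j a b := by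
  unfold dist
  split_ifs <;> simp_all

lemma Jump.dist_left {a b : Vertex n} (h : Jump j a b) : dist j a (false, j) = 1 := by
  rw [dist_eq_one_iff]
  rcases h with ⟨hj, h, rfl⟩ | ⟨hj, rfl, h⟩
  · refine ⟨?_, ?_⟩
    · rintro rfl
      exact absurd h (lt_irrefl _)
    · rintro (⟨-, -, h'⟩ | ⟨h', -⟩)
      · simp at h'
      · exact hj.ne' h'
  · refine ⟨by simp, ?_⟩
    rintro (⟨h', -⟩ | ⟨-, -, h'⟩)
    · exact h'.ne' hj
    · exact absurd h' (lt_irrefl _)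

lemma Jump.dist_right {a b : Vertex n} (h : Jump j a b) : dist j (false, j) b = 1 := by
  rw [dist_eq_one_iff]
  rcases h with ⟨hj, h, rfl⟩ | ⟨hj, rfl, h⟩
  · refine ⟨by simp, ?_⟩
    rintro (⟨-, h', -⟩ | ⟨h', -⟩)
    · exact absurd h' (lt_irrefl _)
    · exact hj.ne' h'
  · refine ⟨?_, ?_⟩
    · rintro rfl
      exact absurd h (lt_irrefl _)
    · rintro (⟨h', -⟩ | ⟨-, h', -⟩)
      · exact h'.ne' hj
      · simp at h'

/-- Distances are at most 2, and distinct vertices are at distance at least 1. -/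
lemma dist_triangle (a b c : Vertex n) :
    dist j a c ≤ dist j a b + dist j b c := by
  by_cases h₁ : a = b
  · simp [h₁]
  by_cases h₂ : b = c
  · simp [h₂]
  have h₁' : dist j a b ≠ 0 := fun h ↦ h₁ (eq_of_dist_eq_zero h)
  have h₂' : dist j b c ≠ 0 := fun h ↦ h₂ (eq_of_dist_eq_zero h)
  have := dist_le_two (j := j) a c
  omega

end Vertex

/-! ### Admissible and reduced paths. -/

namespace Path

open Vertex

variable {n : ℕ} (j : Fin (n + 1))

/-- The length of the part of a path of vertices up to its `x`-th vertex. -/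
def len {r : ℕ} (v : Fin (r + 1) → Vertex n) (x : Fin (r + 1)) : ℕ :=
  ∑ y : Fin r, if y.castSucc < x then dist j (v y.castSucc) (v y.succ) else 0

variable {r : ℕ} (v : Fin (r + 1) → Vertex n)

@[simp] lemma len_zero : len j v 0 = 0 := by
  simp [len]

lemma len_succ (y : Fin r) :
    len j v y.succ = len j v y.castSucc + dist j (v y.castSucc) (v y.succ) := by
  have : dist j (v y.castSucc) (v y.succ) =
      ∑ z : Fin r, if z = y then dist j (v z.castSucc) (v z.succ) else 0 := by
    simp
  rw [this, len, len, ← Finset.sum_add_distrib]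
  refine Finset.sum_congr rfl fun z _ ↦ ?_
  rcases lt_trichotomy z y with h | rfl | h
  · simp [h, h.ne, Fin.castSucc_lt_succ_iff, h.le]
  · simp
  · simp [h.not_gt, h.ne', Fin.castSucc_lt_succ_iff, h.not_ge]

/-- To prove a relation for `x ≤ y` it suffices to treat one step at a time. -/
lemma le_induction {x : Fin (r + 1)} {p : Fin (r + 1) → Prop} (h₀ : p x)
    (h : ∀ y : Fin r, x ≤ y.castSucc → p y.castSucc → p y.succ) (y : Fin (r + 1)) (hxy : x ≤ y) :
    p y := by
  induction y using Fin.induction with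
  | zero =>
    obtain rfl : x = 0 := le_antisymm hxy (Fin.zero_le _)
    exact h₀
  | succ y ih =>
    rcases hxy.lt_or_eq with h' | rfl
    · have h'' : x ≤ y.castSucc := Fin.le_castSucc_iff.2 h'
      exact h y h'' (ih h'')
    · exact h₀

lemma len_mono : Monotone (len j v) := by
  intro x y hxy
  refine le_induction (p := fun y ↦ len j v x ≤ len j v y) le_rfl (fun y _ ih ↦ ?_) y hxy
  rw [len_succ]
  omega

variable {v}

lemma dist_le_len {x y : Fin (r + 1)} (hxy : x ≤ y) :
    len j v x + dist j (v x) (v y) ≤ len j v y := by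
  refine le_induction (p := fun y ↦ len j v x + dist j (v x) (v y) ≤ len j v y)
    (by simp [dist_self]) (fun y hy ih ↦ ?_) y hxy
  rw [len_succ]
  have := dist_triangle (j := j) (v x) (v y.castSucc) (v y.succ)
  omega

lemma eq_of_len_eq {x y : Fin (r + 1)}
    (h : len j v x = len j v y) : v x = v y := by
  rcases le_total x y with hxy | hxy
  · have := dist_le_len j (v := v) hxy
    exact eq_of_dist_eq_zero (j := j) (by omega)
  · have := dist_le_len j (v := v) hxy
    exact (eq_of_dist_eq_zero (j := j) (by omega)).symm

/-- By the triangle inequality, dropping or repeating vertices cannot lengthen any stretch of a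
path. This makes `lengthFiltration` stable under cellular operators. -/
lemma len_comp_le {s : ℕ} {g : Fin (s + 1) → Fin (r + 1)}
    (hg : Monotone g) {x y : Fin (s + 1)} (hxy : x ≤ y) :
    len j (v ∘ g) y + len j v (g x) ≤ len j v (g y) + len j (v ∘ g) x := by
  refine le_induction (p := fun y ↦
    len j (v ∘ g) y + len j v (g x) ≤ len j v (g y) + len j (v ∘ g) x)
    (by omega) (fun y hy ih ↦ ?_) y hxy
  rw [len_succ]
  have := dist_le_len j (v := v) (hg (Fin.castSucc_lt_succ (i := y)).le)
  dsimp
  omega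

/-- A monotone function on `Fin (s + 1)` exceeding `i` has a first value exceeding `i`. -/
lemma exists_crossing {s : ℕ} (a : Fin (s + 1) → ℕ) (i : ℕ) (h₀ : a 0 ≤ i)
    (x : Fin (s + 1)) (hx : i < a x) : ∃ y : Fin s, a y.castSucc ≤ i ∧ i < a y.succ := by
  induction x using Fin.induction with
  | zero => omega
  | succ y ih =>
    by_cases h : i < a y.castSucc
    · exact ih h
    · exact ⟨y, by omega, hx⟩

/-- The paths having a first coordinate `1` in the `j`-th fibre, but not over larger vertices. -/
structure IsAdmissible (v : Fin (r + 1) → Vertex n) : Prop where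
  mono : Monotone fun x ↦ (v x).2
  surj : ∀ i, ∃ x, (v x).2 = i
  above : ∀ x, j < (v x).2 → (v x).1 = false
  mem : ∃ x, v x = (true, j)

/-- The admissible paths all of whose steps have length one. -/
structure IsReduced {m : ℕ} (w : Fin (m + 1) → Vertex n) : Prop extends IsAdmissible j w where
  step : ∀ i : Fin m, dist j (w i.castSucc) (w i.succ) = 1

variable {j}

section Reduced

variable {m : ℕ} {w : Fin (m + 1) → Vertex n}

lemma IsReduced.len_eq (hw : IsReduced j w) (x : Fin (m + 1)) : len j w x = x := by
  induction x using Fin.induction with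
  | zero => simp
  | succ y ih =>
    rw [len_succ, ih, hw.step]
    simp

lemma IsReduced.dist_of_val_eq (hw : IsReduced j w) {x y : Fin (m + 1)} (h : y.val = x.val + 1) :
    dist j (w x) (w y) = 1 := by
  have hx : x.val < m := by have := y.2; omega
  have := hw.step ⟨x, hx⟩
  have e : (⟨x, hx⟩ : Fin m).succ = y := Fin.ext (by simp [h])
  rw [e] at this
  exact this

/-- The vertex `k` of the path `w` is `(0, j)`, and it is the only middle vertex of a jump. -/
structure IsPivot (j : Fin (n + 1)) (w : Fin (m + 1) → Vertex n) (k : Fin (m + 1)) : Prop where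
  pos : 0 < k
  lt_last : k < Fin.last m
  eq : w k = (false, j)
  jump_iff : ∀ x y : Fin (m + 1), y.val = x.val + 2 → (Jump j (w x) (w y) ↔ x.val + 1 = k.val)

/-- The pivot is the first vertex in the fibre over `j`. Entering at (1, j) would be a jump, which a
reduced path excludes, so it is (0, j). Some vertex over 0 precedes it and an occurrence of (1, j)
follows it. -/
lemma IsReduced.exists_isPivot_of_pos (hj : 0 < j) (hw : IsReduced j w) :
    ∃ k, IsPivot j w k := by
  obtain ⟨x₀, hx₀⟩ := hw.surj j
  obtain ⟨k, hk : j ≤ (w k).2, hmin⟩ := WellFounded.has_min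
    (wellFounded_lt (α := Fin (m + 1))) {x | j ≤ (w x).2} ⟨x₀, hx₀.ge⟩
  have hlt (x) (hx : x < k) : (w x).2 < j := lt_of_not_ge fun h ↦ hmin x h hx
  have hge (x) (hx : j ≤ (w x).2) : k ≤ x := le_of_not_gt fun h ↦ hmin x hx h
  have hkj : (w k).2 = j := le_antisymm (hx₀ ▸ hw.mono (hge x₀ hx₀.ge)) hk
  obtain ⟨x₁, hx₁⟩ := hw.surj 0
  have hpos : 0 < k := by
    refine lt_of_le_of_ne (Fin.zero_le _) ?_
    rintro rfl
    have := hw.mono (Fin.zero_le x₁)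
    dsimp only at this
    rw [hx₁, hkj] at this
    exact absurd hj this.not_gt
  have hpos' : 0 < k.val := hpos
  have hne : w k ≠ (true, j) := by
    intro h
    have h₁ := hw.dist_of_val_eq (x := ⟨k.val - 1, by omega⟩) (y := k) (by dsimp; omega)
    exact (dist_eq_one_iff.1 h₁).2 (Or.inl ⟨hj, hlt _ (Fin.lt_def.2 (by dsimp; omega)), h⟩)
  have hkw : w k = (false, j) := by
    rcases h : w k with ⟨_ | _, i⟩
    · rw [h] at hkj
      exact Prod.ext rfl hkj
    · rw [h] at hkj hne
      exact absurd (show ((true, i) : Vertex n) = (true, j) from Prod.ext rfl hkj) hne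
  obtain ⟨t, ht⟩ := hw.mem
  have hkt : k < t := by
    refine lt_of_le_of_ne (hge t (by rw [ht])) ?_
    rintro rfl
    exact hne ht
  refine ⟨k, hpos, hkt.trans_le (Fin.le_last t), hkw, fun x y hxy ↦ ⟨?_, fun hx ↦ ?_⟩⟩
  · rintro (⟨-, h, h'⟩ | ⟨h, -⟩)
    · have h₁ : x < k := lt_of_not_ge fun h₂ ↦ absurd (hw.mono h₂) (by
        dsimp only
        rw [hkj]
        exact h.not_ge)
      have h₂ : k ≤ y := hge y (by rw [h'])
      have h₃ : k ≠ y := by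
        rintro rfl
        exact hne h'
      rw [Fin.lt_def] at h₁
      rw [Fin.le_def] at h₂
      rw [Ne, Fin.ext_iff] at h₃
      omega
    · exact absurd h hj.ne'
  -- The vertex after the pivot lies between it and an occurrence of (1, j), hence over `j`; being
  -- different from (0, j), it is (1, j).
  · refine Or.inl ⟨hj, hlt x (Fin.lt_def.2 (by omega)), ?_⟩
    have h₁ := (dist_eq_one_iff.1 (hw.dist_of_val_eq (x := k) (y := y) (by omega))).1
    have h₂ : k ≤ y := Fin.le_def.2 (by omega)
    have h₃ : y ≤ t := Fin.le_def.2 (by rw [Fin.lt_def] at hkt; omega)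
    have h₄ : (w y).2 = j := by
      refine le_antisymm ?_ (hkj ▸ hw.mono h₂)
      have := hw.mono h₃
      dsimp only at this
      rw [ht] at this
      exact this
    rcases h : w y with ⟨_ | _, i⟩
    · rw [h] at h₄ h₁
      dsimp at h₄
      subst h₄
      exact absurd hkw h₁
    · rw [h] at h₄
      exact Prod.ext rfl h₄

/-- Dually, the pivot is the last vertex over 0. An occurrence of (1, 0) precedes it, and `0 < n`
provides a vertex over a larger point after it. -/
lemma IsReduced.exists_isPivot_of_eq_zero (hn : 0 < n) (hj : j = 0) (hw : IsReduced j w) :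
    ∃ k, IsPivot j w k := by
  obtain ⟨x₀, hx₀⟩ := hw.surj j
  obtain ⟨k, hk : (w k).2 ≤ j, hmax⟩ := WellFounded.has_min
    (wellFounded_gt (α := Fin (m + 1))) {x | (w x).2 ≤ j} ⟨x₀, hx₀.le⟩
  have hlt (x) (hx : k < x) : j < (w x).2 := lt_of_not_ge fun h ↦ hmax x h hx
  have hge (x) (hx : (w x).2 ≤ j) : x ≤ k := le_of_not_gt fun h ↦ hmax x hx h
  have hkj : (w k).2 = j := le_antisymm hk (by rw [hj]; exact Fin.zero_le _)
  obtain ⟨x₁, hx₁⟩ := hw.surj (Fin.last n)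
  have hlast : k < Fin.last m := by
    refine lt_of_le_of_ne (Fin.le_last _) ?_
    intro h
    have := hw.mono (Fin.le_last x₁)
    dsimp only at this
    rw [hx₁, ← h, hkj, hj, Fin.le_def] at this
    simp at this
    omega
  have hlast' : k.val < m := hlast
  have hne : w k ≠ (true, j) := by
    intro h
    have h₁ := hw.dist_of_val_eq (x := k) (y := ⟨k.val + 1, by omega⟩) (by dsimp)
    exact (dist_eq_one_iff.1 h₁).2 (Or.inr ⟨hj, h, hlt _ (Fin.lt_def.2 (by dsimp; omega))⟩)
  have hkw : w k = (false, j) := by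
    rcases h : w k with ⟨_ | _, i⟩
    · rw [h] at hkj
      exact Prod.ext rfl hkj
    · rw [h] at hkj hne
      exact absurd (show ((true, i) : Vertex n) = (true, j) from Prod.ext rfl hkj) hne
  obtain ⟨t, ht⟩ := hw.mem
  have hkt : t < k := by
    refine lt_of_le_of_ne (hge t (by rw [ht])) ?_
    rintro rfl
    exact hne ht
  refine ⟨k, (Fin.zero_le t).trans_lt hkt, hlast, hkw, fun x y hxy ↦ ⟨?_, fun hx ↦ ?_⟩⟩
  · rintro (⟨h, -⟩ | ⟨-, h', h⟩)
    · exact absurd hj h.ne'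
    · have h₁ : k < y := lt_of_not_ge fun h₂ ↦ absurd (hw.mono h₂) (by
        dsimp only
        rw [hkj]
        exact h.not_ge)
      have h₂ : x ≤ k := hge x (by rw [h'])
      have h₃ : k ≠ x := by
        rintro rfl
        exact hne h'
      rw [Fin.lt_def] at h₁
      rw [Fin.le_def] at h₂
      rw [Ne, Fin.ext_iff] at h₃
      omega
  · refine Or.inr ⟨hj, ?_, hlt y (Fin.lt_def.2 (by omega))⟩
    have h₁ := (dist_eq_one_iff.1 (hw.dist_of_val_eq (x := x) (y := k) (by omega))).1
    have h₄ : (w x).2 = j := by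
      refine le_antisymm ?_ (by rw [hj]; exact Fin.zero_le _)
      rw [← hkj]
      exact hw.mono (Fin.le_def.2 (by omega))
    rcases h : w x with ⟨_ | _, i⟩
    · rw [h] at h₄ h₁
      dsimp at h₄
      subst h₄
      exact absurd hkw.symm h₁
    · rw [h] at h₄
      exact Prod.ext rfl h₄

lemma IsReduced.exists_isPivot (hn : 0 < n) (hw : IsReduced j w) : ∃ k, IsPivot j w k := by
  by_cases hj : j = 0
  · exact hw.exists_isPivot_of_eq_zero hn hj
  · exact hw.exists_isPivot_of_pos (Fin.pos_iff_ne_zero.2 hj)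

variable {k : Fin (m + 1)} {s : ℕ} {g : Fin (s + 1) → Fin (m + 1)}

lemma map_zero_of_hits (hg : Monotone g) (h : ∃ x, g x = 0) : g 0 = 0 := by
  obtain ⟨x, hx⟩ := h
  exact le_antisymm (hx ▸ hg (Fin.zero_le x)) (Fin.zero_le _)

lemma map_last_of_hits (hg : Monotone g) (h : ∃ x, g x = Fin.last m) :
    g (Fin.last s) = Fin.last m := by
  obtain ⟨x, hx⟩ := h
  exact le_antisymm (Fin.le_last _) (hx ▸ hg (Fin.le_last x))

lemma not_hit_of_between (hg : Monotone g) {y : Fin s} {i : Fin (m + 1)}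
    (h₁ : g y.castSucc < i) (h₂ : i < g y.succ) (x) : g x ≠ i := by
  rintro rfl
  rcases le_or_gt x y.castSucc with h | h
  · exact absurd h₁ (hg h).not_gt
  · exact absurd h₂ (hg (Fin.castSucc_lt_iff_succ_le.1 h)).not_gt

/-- The only vertex `g` may skip is the pivot, and the step across it is then a jump, of length 2;
so no length is lost. -/
lemma IsReduced.len_comp_eq (hw : IsReduced j w) (hk : IsPivot j w k) (hg : Monotone g)
    (hits : ∀ i, i ≠ k → ∃ x, g x = i) (x : Fin (s + 1)) : len j (w ∘ g) x = g x := by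
  induction x using Fin.induction with
  | zero =>
    rw [map_zero_of_hits hg (hits 0 hk.pos.ne)]
    simp
  | succ y ih =>
    rw [len_succ, ih]
    dsimp only [Function.comp_apply]
    have hle : (g y.castSucc).val ≤ (g y.succ).val := hg (Fin.castSucc_lt_succ (i := y)).le
    have hlt := (g y.succ).2
    obtain h | h | h | h : (g y.succ).val = (g y.castSucc).val ∨
      (g y.succ).val = (g y.castSucc).val + 1 ∨ (g y.succ).val = (g y.castSucc).val + 2 ∨
      (g y.castSucc).val + 3 ≤ (g y.succ).val := by omega
    · rw [Fin.ext h, dist_self]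
      omega
    · rw [hw.dist_of_val_eq h, h]
    · have hk' : (g y.castSucc).val + 1 = k.val := by
        by_contra hne
        obtain ⟨x, hx⟩ := hits ⟨(g y.castSucc).val + 1, by omega⟩ (fun h ↦ hne (congr_arg Fin.val h))
        exact not_hit_of_between hg (y := y) (Fin.lt_def.2 (by dsimp; omega))
          (Fin.lt_def.2 (by dsimp; omega)) x hx
      rw [dist_eq_two_iff.2 ((hk.jump_iff _ _ h).2 hk'), h]
    -- A gap of three or more would skip two distinct vertices, but only `k` may be skipped.
    · exfalso
      have key (i : Fin (m + 1)) (h₁ : g y.castSucc < i) (h₂ : i < g y.succ) : i = k := by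
        by_contra hne
        obtain ⟨x, hx⟩ := hits i hne
        exact not_hit_of_between hg h₁ h₂ x hx
      have h₁ := key ⟨(g y.castSucc).val + 1, by omega⟩ (Fin.lt_def.2 (by dsimp; omega))
        (Fin.lt_def.2 (by dsimp; omega))
      have h₂ := key ⟨(g y.castSucc).val + 2, by omega⟩ (Fin.lt_def.2 (by dsimp; omega))
        (Fin.lt_def.2 (by dsimp; omega))
      rw [Fin.ext_iff] at h₁ h₂
      dsimp at h₁ h₂
      omega

/-- If no length were lost, `g` would run from 0 to `m` and step across `i`. The estimates before
and after this step force its length to equal its gap, which is at least 2; so it is a jump, and its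
middle vertex `i` is the pivot. -/
lemma IsReduced.len_comp_lt (hw : IsReduced j w) (hk : IsPivot j w k) (hg : Monotone g)
    {i : Fin (m + 1)} (hi : i ≠ k) (hgi : ∀ x, g x ≠ i) :
    len j (w ∘ g) (Fin.last s) < m := by
  by_contra! hle
  have h₁ := len_comp_le j (v := w) hg (Fin.zero_le (Fin.last s))
  rw [hw.len_eq, hw.len_eq, len_zero] at h₁
  have hm := (g (Fin.last s)).2
  have hi' : (g 0).val ≤ i.val ∧ i.val < (g (Fin.last s)).val := by
    have h₂ := hgi (Fin.last s)
    rw [Ne, Fin.ext_iff] at h₂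
    have := i.2
    omega
  obtain ⟨y, hy, hy'⟩ := exists_crossing (fun x ↦ (g x).val) i.val hi'.1 (Fin.last s) hi'.2
  have hy'' : (g y.castSucc).val ≠ i.val := fun h ↦ hgi _ (Fin.ext h)
  have h₂ := len_comp_le j (v := w) hg (Fin.le_last y.succ)
  have h₃ := len_comp_le j (v := w) hg (Fin.zero_le y.castSucc)
  rw [hw.len_eq, hw.len_eq, len_succ] at h₂
  rw [hw.len_eq, hw.len_eq, len_zero] at h₃
  dsimp only [Function.comp_apply] at h₂
  have h₄ := dist_le_two (j := j) (w (g y.castSucc)) (w (g y.succ))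
  have h₅ := (hk.jump_iff (g y.castSucc) (g y.succ) (by omega)).1
    (dist_eq_two_iff.1 (by omega))
  exact hi (Fin.ext (by omega))

lemma IsReduced.isAdmissible_comp (hw : IsReduced j w) (hk : IsPivot j w k) (hg : Monotone g)
    (hits : ∀ i, i ≠ k → ∃ x, g x = i) : IsAdmissible j (w ∘ g) := by
  obtain ⟨t, ht⟩ := hw.mem
  obtain ⟨x, hx⟩ := hits t (by
    rintro rfl
    rw [hk.eq] at ht
    simp at ht)
  refine ⟨fun x y h ↦ hw.mono (hg h), fun i ↦ ?_, fun x ↦ hw.above _, x, ?_⟩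
  · obtain ⟨y, hy⟩ := hw.surj i
    by_cases hyk : y = k
    -- The pivot may be missed by `g`, but (1, j) is hit and lies in the same fibre.
    · refine ⟨x, ?_⟩
      rw [← hy, hyk, hk.eq, Function.comp_apply, hx, ht]
    · obtain ⟨z, rfl⟩ := hits y hyk
      exact ⟨z, hy⟩
  · rw [Function.comp_apply, hx, ht]

/-- By `IsReduced.len_comp_eq`, `g` is the length function of the composite. Then `w` is known on
the values of `g`, and the vertex possibly missed is (0, j) on both sides. -/
lemma IsReduced.unique {w' : Fin (m + 1) → Vertex n} {k' : Fin (m + 1)}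
    {g' : Fin (s + 1) → Fin (m + 1)} (hw : IsReduced j w) (hk : IsPivot j w k) (hg : Monotone g)
    (hits : ∀ i, i ≠ k → ∃ x, g x = i) (hw' : IsReduced j w') (hk' : IsPivot j w' k')
    (hg' : Monotone g') (hits' : ∀ i, i ≠ k' → ∃ x, g' x = i) (h : w ∘ g = w' ∘ g') :
    w = w' ∧ g = g' := by
  have hgg : g = g' := by
    funext x
    apply Fin.ext
    rw [← hw.len_comp_eq hk hg hits, ← hw'.len_comp_eq hk' hg' hits', h]
  subst hgg
  refine ⟨funext fun i ↦ ?_, rfl⟩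
  by_cases hi : ∃ x, g x = i
  · obtain ⟨x, rfl⟩ := hi
    exact congr_fun h x
  · have h₁ : i = k := by
      by_contra hne
      exact hi (hits i hne)
    have h₂ : i = k' := by
      by_contra hne
      exact hi (hits' i hne)
    rw [h₁, hk.eq, ← h₁, h₂, hk'.eq]

end Reduced

/-- Every admissible path factors through a reduced one by inserting the missing vertices
`(0, j)` and deleting the repetitions. -/
theorem IsAdmissible.exists_isReduced {v : Fin (r + 1) → Vertex n} (hv : IsAdmissible j v) {m : ℕ}
    (hm : len j v (Fin.last r) = m) :
    ∃ w : Fin (m + 1) → Vertex n, IsReduced j w ∧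
      (∀ (i : Fin (m + 1)) x, len j v x = i.val → w i = v x) ∧
      ∀ i : Fin (m + 1), (∃ x, len j v x = i.val) ∨
        ∃ a b : Fin (m + 1), b.val = a.val + 2 ∧ a.val + 1 = i.val ∧ Jump j (w a) (w b) := by
  classical
  -- Position `i` carries the vertex of `v` reached at length `i`. Lengths not attained are
  -- midpoints of jumps, whence the default (0, j).
  let w (i : Fin (m + 1)) : Vertex n :=
    if h : ∃ x, len j v x = i.val then v h.choose else (false, j)
  have hwv (i : Fin (m + 1)) (x) (h : len j v x = i.val) : w i = v x := by
    have h' : ∃ x, len j v x = i.val := ⟨x, h⟩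
    rw [show w i = v h'.choose from dif_pos h']
    exact eq_of_len_eq j (h'.choose_spec.trans h.symm)
  have hwz (i : Fin (m + 1)) (y : Fin r) (h₁ : len j v y.castSucc < i.val)
      (h₂ : i.val < len j v y.succ) : w i = (false, j) := by
    refine dif_neg ?_
    rintro ⟨x, hx⟩
    rcases le_or_gt x y.castSucc with h | h
    · have := len_mono j v h
      omega
    · have := len_mono j v (Fin.castSucc_lt_iff_succ_le.1 h)
      omega
  have hle (x) : len j v x ≤ m := hm ▸ len_mono j v (Fin.le_last x)
  have hcross (i : ℕ) (hi : i < m) :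
      ∃ y : Fin r, len j v y.castSucc ≤ i ∧ i < len j v y.succ :=
    exists_crossing (len j v) i (by simp) (Fin.last r) (by omega)
  have key (i : Fin m) : dist j (w i.castSucc) (w i.succ) = 1 ∧
      (w i.castSucc).2 ≤ (w i.succ).2 := by
    obtain ⟨y, hy, hy'⟩ := hcross i.val i.2
    have hs := len_succ j v y
    have h2 := dist_le_two (j := j) (v y.castSucc) (v y.succ)
    have hmo := hv.mono (Fin.castSucc_lt_succ (i := y)).le
    dsimp only at hmo
    -- If the step of `v` over position `i` is a jump, the unit step of `w` is its first or its
    -- second half; otherwise it is the step of `v` itself.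
    by_cases hd : dist j (v y.castSucc) (v y.succ) = 2
    · have hjump := dist_eq_two_iff.1 hd
      obtain h | h : len j v y.castSucc = i.val ∨ len j v y.castSucc + 1 = i.val := by omega
      · rw [hwv i.castSucc y.castSucc (by simpa using h),
          hwz i.succ y (by simp; omega) (by simp; omega)]
        exact ⟨hjump.dist_left, hjump.le_left⟩
      · rw [hwz i.castSucc y (by simp; omega) (by simp; omega),
          hwv i.succ y.succ (by simp; omega)]
        exact ⟨hjump.dist_right, hjump.le_right⟩
    · rw [hwv i.castSucc y.castSucc (by simp; omega), hwv i.succ y.succ (by simp; omega)]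
      exact ⟨by omega, hmo⟩
  refine ⟨w, ⟨⟨?_, ?_, ?_, ?_⟩, fun i ↦ (key i).1⟩, hwv, ?_⟩
  · exact Fin.monotone_iff_le_succ.2 fun i ↦ (key i).2
  · intro i
    obtain ⟨x, rfl⟩ := hv.surj i
    exact ⟨⟨len j v x, by have := hle x; omega⟩, by rw [hwv _ x rfl]⟩
  · intro i hi
    by_cases h : ∃ x, len j v x = i.val
    · obtain ⟨x, hx⟩ := h
      rw [hwv i x hx] at hi ⊢
      exact hv.above x hi
    · rw [show w i = (false, j) from dif_neg h]
  · obtain ⟨x, hx⟩ := hv.mem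
    exact ⟨⟨len j v x, by have := hle x; omega⟩, by rw [hwv _ x rfl, hx]⟩
  · intro i
    by_cases h : ∃ x, len j v x = i.val
    · exact Or.inl h
    · refine Or.inr ?_
      have hi : i.val < m := by
        refine lt_of_le_of_ne (Nat.lt_succ_iff.1 i.2) fun hi ↦ h ⟨Fin.last r, by omega⟩
      obtain ⟨y, hy, hy'⟩ := hcross i.val hi
      have hy'' : len j v y.castSucc ≠ i.val := fun h' ↦ h ⟨_, h'⟩
      have hs := len_succ j v y
      have h2 := dist_le_two (j := j) (v y.castSucc) (v y.succ)
      have hm' := hle y.succ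
      refine ⟨⟨len j v y.castSucc, by omega⟩, ⟨len j v y.succ, by omega⟩, ?_, ?_, ?_⟩
      · dsimp; omega
      · dsimp; omega
      · rw [hwv _ y.castSucc rfl, hwv _ y.succ rfl]
        exact dist_eq_two_iff.1 (by omega)

end Path

end

noncomputable section

open Theta2 Path

/-! ### Dominant cellular operators. -/

namespace Theta2

lemma Hom.vert_congr {X Y : Theta2} {f g : Hom X Y} (h : f = g) (l k hf hg) :
    f.vert l k hf = g.vert l k hg := by
  subst h
  rfl

/-- A surjective monotone map rises by at most one at each step. Hence a step of a reduced path has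
at most one vertical component. -/
lemma Covers.unique_right {m n : ℕ} {α : ⦋m⦌ ⟶ ⦋n⦌} (hα : ∀ i, ∃ x, α.toOrderHom x = i)
    {l : Fin m} {k k' : Fin n} (h : Covers α l k) (h' : Covers α l k') : k = k' := by
  have key {k k' : Fin n} (h : Covers α l k) (h' : Covers α l k') : ¬ k < k' := by
    intro hlt
    rw [Fin.lt_def] at hlt
    obtain ⟨x, hx⟩ := hα k.succ
    have hx' : (α.toOrderHom x).val = k.val + 1 := by simp [hx]
    rcases le_or_gt x l.castSucc with hxl | hxl
    · have := Fin.le_def.1 (α.toOrderHom.monotone hxl)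
      have := h.1
      omega
    · have := Fin.le_def.1 (α.toOrderHom.monotone (Fin.castSucc_lt_iff_succ_le.1 hxl))
      have := h'.2
      omega
  exact le_antisymm (le_of_not_gt (key h' h)) (le_of_not_gt (key h h'))

lemma exists_covers {m n : ℕ} (α : ⦋m⦌ ⟶ ⦋n⦌) (h₀ : ∃ x, α.toOrderHom x = 0)
    (h₁ : ∃ x, α.toOrderHom x = Fin.last n) (k : Fin n) : ∃ l, Covers α l k := by
  obtain ⟨x, hx⟩ := h₀
  obtain ⟨y, hy⟩ := h₁
  obtain ⟨l, hl, -⟩ := exists_covers_of_bounds α k x y (by simp [hx]) (by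
    rw [hy]
    simp only [Fin.val_last]
    omega)
  exact ⟨l, hl⟩

/-- A cellular operator is dominant if it is not in the boundary of its target. -/
structure IsDominant {X Y : Theta2} (f : X ⟶ Y) : Prop where
  base : ∀ i, ∃ x, (Hom.base f).toOrderHom x = i
  vert : ∀ k, ∃ l h, Function.Surjective (Hom.vert f l k h).toOrderHom

lemma isDominant_iff {θ : Theta2} {U : Theta2ᵒᵖ} (f : U.unop ⟶ θ) :
    IsDominant f ↔ f ∉ (Subfunctor.range (boundaryInclusion θ)).obj U := by
  rw [mem_range_boundaryInclusion]
  push Not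
  exact ⟨fun h ↦ ⟨h.base, h.vert⟩, fun h ↦ ⟨h.1, h.2⟩⟩

end Theta2

variable {θ : Theta2}

/-! ### The filtration of the cylinder. -/

section Filtration

/-- The path of vertices of `J × Δ[n]` underlying a cell of `J × Θ₂[n; q]`. -/
def cellPath {U : Theta2ᵒᵖ} (c : (cylinder θ).obj U) (x : Fin (U.unop.n + 1)) : Vertex θ.n :=
  (Prod.fst c x, (Hom.base (Prod.snd c : U.unop ⟶ θ)).toOrderHom x)

lemma cellPath_map {U V : Theta2ᵒᵖ} (g : U ⟶ V) (c : (cylinder θ).obj U) :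
    cellPath ((cylinder θ).map g c) = cellPath c ∘ (Hom.base g.unop).toOrderHom := rfl

variable (θ) in
/-- The cells which are in the boundary, or which are labelled `0` over all vertices from `j` on. -/
def fibreFiltration (j : ℕ) : Subfunctor (cylinder θ) where
  obj U := {c | Prod.snd c ∈ (Subfunctor.range (boundaryInclusion θ)).obj U ∨
    ∀ x, j ≤ (cellPath c x).2.val → (cellPath c x).1 = false}
  map {U V} g := by
    rintro c (h | h)
    · exact Or.inl ((Subfunctor.range (boundaryInclusion θ)).map g h)
    · exact Or.inr fun x hx ↦ h _ hx

lemma fibreFiltration_mono {j j' : ℕ} (h : j ≤ j') : fibreFiltration θ j ≤ fibreFiltration θ j' := by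
  rintro U c (hc | hc)
  · exact Or.inl hc
  · exact Or.inr fun x hx ↦ hc x (h.trans hx)

lemma fibreFiltration_zero : fibreFiltration θ 0 = cylinderEnd θ := by
  ext U ⟨u, f⟩
  refine Iff.trans ?_ (or_comm.trans (mem_cylinderEnd θ u f).symm)
  exact or_congr_right ⟨fun h x ↦ h x (Nat.zero_le _), fun h x _ ↦ h x⟩

lemma fibreFiltration_last : fibreFiltration θ (θ.n + 1) = ⊤ := by
  refine le_antisymm le_top fun U c _ ↦ Or.inr fun x hx ↦ ?_
  have := (cellPath c x).2.2
  omega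

/-- The filtration between consecutive steps of `fibreFiltration` by the length of paths. -/
def lengthFiltration (j : Fin (θ.n + 1)) (m : ℕ) : Subfunctor (cylinder θ) where
  obj U := {c | c ∈ (fibreFiltration θ j).obj U ∨
    (c ∈ (fibreFiltration θ (j + 1)).obj U ∧ len j (cellPath c) (Fin.last _) < m)}
  map {U V} g := by
    rintro c (h | ⟨h, h'⟩)
    · exact Or.inl ((fibreFiltration θ j).map g h)
    · refine Or.inr ⟨(fibreFiltration θ (j + 1)).map g h, ?_⟩
      rw [cellPath_map]
      have h₁ := len_comp_le j (r := U.unop.n) (s := V.unop.n) (v := cellPath c)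
        (Hom.base g.unop).toOrderHom.monotone (Fin.zero_le (Fin.last _))
      have h₂ : len j (cellPath c) ((Hom.base g.unop).toOrderHom (Fin.last V.unop.n)) ≤
          len j (cellPath c) (Fin.last U.unop.n) := len_mono j (cellPath c) (Fin.le_last _)
      rw [len_zero] at h₁
      omega

variable {j : Fin (θ.n + 1)}

lemma lengthFiltration_le_succ (m : ℕ) : lengthFiltration j m ≤ lengthFiltration j (m + 1) := by
  rintro U c (h | ⟨h, h'⟩)
  · exact Or.inl h
  · exact Or.inr ⟨h, by omega⟩

lemma lengthFiltration_zero : lengthFiltration j 0 = fibreFiltration θ j := by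
  refine le_antisymm ?_ fun U c h ↦ Or.inl h
  rintro U c (h | ⟨-, h⟩)
  · exact h
  · omega

lemma iSup_lengthFiltration : ⨆ m, lengthFiltration j m = fibreFiltration θ (j + 1) := by
  refine le_antisymm (iSup_le fun m ↦ ?_) fun U c h ↦ ?_
  · rintro U c (h | ⟨h, -⟩)
    · exact fibreFiltration_mono (Nat.le_succ _) _ h
    · exact h
  · rw [Subfunctor.iSup_obj, Set.mem_iUnion]
    exact ⟨len j (cellPath c) (Fin.last _) + 1, Or.inr ⟨h, Nat.lt_succ_self _⟩⟩

/-- A new cell is outside the boundary, and has a label 1 over some vertex from `j` on; labels above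
`j` vanish, so this vertex is `j`. -/
lemma isAdmissible_of_mem {U : Theta2ᵒᵖ} {c : (cylinder θ).obj U}
    (h : c ∈ (fibreFiltration θ (j + 1)).obj U) (h' : c ∉ (fibreFiltration θ j).obj U) :
    IsDominant (Prod.snd c : U.unop ⟶ θ) ∧ IsAdmissible j (cellPath c) := by
  have hd : Prod.snd c ∉ (Subfunctor.range (boundaryInclusion θ)).obj U := fun hc ↦ h' (Or.inl hc)
  have hdom := (isDominant_iff _).2 hd
  have h₁ := h.resolve_left hd
  have h₂ : ¬ ∀ x, j.val ≤ (cellPath c x).2.val → (cellPath c x).1 = false := fun hc ↦ h' (Or.inr hc)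
  push Not at h₂
  obtain ⟨x, hx, hx'⟩ := h₂
  refine ⟨hdom, fun x y hxy ↦ (Hom.base (Prod.snd c : U.unop ⟶ θ)).toOrderHom.monotone hxy,
    hdom.base, fun x hx ↦ h₁ x hx, x, ?_⟩
  have hx₁ : (cellPath c x).1 = true := by simpa using hx'
  refine Prod.ext hx₁ (Fin.ext (le_antisymm ?_ hx))
  by_contra hlt
  have := h₁ x (Nat.lt_of_not_le hlt)
  rw [hx₁] at this
  simp at this

lemma notMem_of_isAdmissible {U : Theta2ᵒᵖ} {c : (cylinder θ).obj U}
    (h : IsDominant (Prod.snd c : U.unop ⟶ θ)) (h' : IsAdmissible j (cellPath c)) :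
    c ∉ (fibreFiltration θ j).obj U := by
  rintro (hc | hc)
  · exact (isDominant_iff _).1 h hc
  · obtain ⟨x, hx⟩ := h'.mem
    have := hc x (by rw [hx])
    rw [hx] at this
    simp at this

end Filtration

/-! ### The cells on reduced paths and their horns. -/

section ReducedCell

variable {j : Fin (θ.n + 1)} {m : ℕ} {w : Fin (m + 1) → Vertex θ.n} (hw : IsReduced j w)

include hw

/-- The simplicial operator underlying a reduced path. -/
def reducedBase : ⦋m⦌ ⟶ ⦋θ.n⦌ := SimplexCategory.mkHom ⟨fun x ↦ (w x).2, hw.mono⟩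

open Classical in
/-- The shape of the nondegenerate cell on a reduced path. -/
def reducedShape : Theta2 where
  n := m
  -- A step that stays in its fibre crosses no entry of θ and receives the entry 0, as nondegeneracy
  -- requires.
  q l := if h : ∃ k, Covers (reducedBase hw) l k then θ.q h.choose else 0

lemma reducedBase_surj (i) : ∃ x, (reducedBase hw).toOrderHom x = i := hw.surj i

lemma reducedShape_q {l : Fin m} {k : Fin θ.n} (h : Covers (reducedBase hw) l k) :
    (reducedShape hw).q l = θ.q k := by
  have h' : ∃ k, Covers (reducedBase hw) l k := ⟨k, h⟩
  rw [h.unique_right (reducedBase_surj hw) h'.choose_spec]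
  exact dif_pos h'

lemma reducedShape_q_of_not {l : Fin m} (h : ¬ ∃ k, Covers (reducedBase hw) l k) :
    (reducedShape hw).q l = 0 := dif_neg h

/-- The cellular operator underlying the nondegenerate cell on a reduced path. -/
def reducedHom : reducedShape hw ⟶ θ :=
  show Hom (reducedShape hw) θ from
  { base := reducedBase hw
    vert := fun _ _ h ↦ eqToHom (by rw [reducedShape_q hw h]) }

/-- The nondegenerate cell on a reduced path. -/
def reducedCell : cellRep (reducedShape hw) ⟶ cylinder θ where
  app U := ↾fun g ↦ (fun x ↦ (w ((Hom.base g).toOrderHom x)).1, g ≫ reducedHom hw)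
  naturality := by
    intro U V f
    ext g
    exact Prod.ext rfl (Category.assoc _ _ _)

end ReducedCell

section ReducedCell

variable {j : Fin (θ.n + 1)} {m : ℕ} {w : Fin (m + 1) → Vertex θ.n} (hw : IsReduced j w)

lemma surjective_comp_eqToHom {a b c : ℕ} (h : (⦋b⦌ : SimplexCategory) = ⦋c⦌) (f : ⦋a⦌ ⟶ ⦋b⦌) :
    Function.Surjective (f ≫ eqToHom h).toOrderHom ↔ Function.Surjective f.toOrderHom := by
  obtain rfl : b = c := congr_arg SimplexCategory.len h
  rw [eqToHom_refl, Category.comp_id]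

lemma surjective_of_eq_zero {a b : ℕ} (h : b = 0) (f : ⦋a⦌ ⟶ ⦋b⦌) :
    Function.Surjective f.toOrderHom := by
  subst h
  exact fun y ↦ ⟨0, Subsingleton.elim (α := Fin 1) _ _⟩

lemma hom_eq_of_eq_zero {a b : ℕ} (h : b = 0) (f g : ⦋a⦌ ⟶ ⦋b⦌) : f = g := by
  subst h
  ext x
  exact congr_arg Fin.val (Subsingleton.elim (α := Fin 1) _ _)

lemma comp_reducedHom_vert {U : Theta2} (g : U ⟶ reducedShape hw) {l : Fin U.n} {i : Fin m}
    {k : Fin θ.n} (hg : Covers (Hom.base g) l i) (hk : Covers (reducedBase hw) i k)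
    (h : Covers (Hom.base (g ≫ reducedHom hw)) l k) :
    Hom.vert (g ≫ reducedHom hw) l k h =
      Hom.vert g l i hg ≫ eqToHom (by rw [reducedShape_q hw hk]) :=
  comp_vert g (reducedHom hw) i hg hk h

lemma covers_comp_reducedHom {U : Theta2} (g : U ⟶ reducedShape hw) {l : Fin U.n} {i : Fin m}
    {k : Fin θ.n} (hg : Covers (Hom.base g) l i) (hk : Covers (reducedBase hw) i k) :
    Covers (Hom.base (g ≫ reducedHom hw)) l k := covers_comp.2 ⟨i, hg, hk⟩

/-- Cellular operators into the shape of a reduced cell are determined by their simplicial part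
and their composite with the reduced cell. -/
lemma reducedShape_hom_ext {U : Theta2} {g g' : U ⟶ reducedShape hw}
    (h : Hom.base g = Hom.base g') (h' : g ≫ reducedHom hw = g' ≫ reducedHom hw) : g = g' := by
  refine Hom.ext' h fun l i hg hg' ↦ ?_
  by_cases hk : ∃ k, Covers (reducedBase hw) i k
  · obtain ⟨k, hk⟩ := hk
    have h₁ := Hom.vert_congr h' l k (covers_comp_reducedHom hw g hg hk)
      (covers_comp_reducedHom hw g' hg' hk)
    rw [comp_reducedHom_vert hw g hg hk, comp_reducedHom_vert hw g' hg' hk] at h₁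
    exact (cancel_mono _).1 h₁
  · exact hom_eq_of_eq_zero (reducedShape_q_of_not hw hk) _ _

/-- The lift of a cellular operator to the shape of a reduced cell. -/
lemma exists_lift {U : Theta2} (f : U ⟶ θ) (g : ⦋U.n⦌ ⟶ ⦋m⦌) (hg : Hom.base f = g ≫ reducedBase hw) :
    ∃ g' : U ⟶ reducedShape hw, Hom.base g' = g ∧ g' ≫ reducedHom hw = f := by
  classical
  let g' : U ⟶ reducedShape hw := show Hom U (reducedShape hw) from
    { base := g
      vert := fun l i h ↦
        if hk : ∃ k, Covers (reducedBase hw) i k then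
          Hom.vert f l hk.choose (hg ▸ covers_comp.2 ⟨i, h, hk.choose_spec⟩) ≫
            eqToHom (by rw [reducedShape_q hw hk.choose_spec])
        -- The target is [0] here, so there is no choice.
        else SimplexCategory.const _ _ 0 }
  refine ⟨g', rfl, Hom.ext' hg.symm fun l k h h' ↦ ?_⟩
  obtain ⟨i, hi, hk⟩ := covers_comp.1 (show Covers (g ≫ reducedBase hw) l k from h)
  refine (comp_reducedHom_vert hw g' hi hk h).trans ?_
  have hk' : ∃ k, Covers (reducedBase hw) i k := ⟨k, hk⟩
  have h₁ : Hom.vert g' l i hi =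
      Hom.vert f l hk'.choose (hg ▸ covers_comp.2 ⟨i, hi, hk'.choose_spec⟩) ≫
        eqToHom (by rw [reducedShape_q hw hk'.choose_spec]) := dif_pos hk'
  rw [h₁, Category.assoc, eqToHom_trans]
  have key (k₁ : Fin θ.n) (hk₁ : k₁ = k) (h₁ : Covers (Hom.base f) l k₁)
      (e : (⦋θ.q k₁⦌ : SimplexCategory) = ⦋θ.q k⦌) :
      Hom.vert f l k₁ h₁ ≫ eqToHom e = Hom.vert f l k h' := by
    subst hk₁
    exact Category.comp_id _
  exact key _ (hk'.choose_spec.unique_right (reducedBase_surj hw) hk) _ _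

variable {k : Fin (m + 1)} (hk : IsPivot j w k) {U : Theta2ᵒᵖ} {g : U.unop ⟶ reducedShape hw}

lemma notMem_horn_iff (g : U.unop ⟶ reducedShape hw) :
    g ∉ (Subfunctor.range (horizontalHornInclusion (reducedShape hw) k)).obj U ↔
      (∀ i, i ≠ k → ∃ x, (Hom.base g).toOrderHom x = i) ∧
        ∀ i, ∃ l h, Function.Surjective (Hom.vert g l i h).toOrderHom := by
  refine (not_congr (mem_range_horizontalHornInclusion (reducedShape hw) k g)).trans ?_
  push Not
  exact Iff.rfl

include hk

/-- These are the cells attached anew: with at most the pivot missed, fibres and length survive, so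
none of them lies in `lengthFiltration j m`. -/
lemma isDominant_of_notMem_horn
    (hg : g ∉ (Subfunctor.range (horizontalHornInclusion (reducedShape hw) k)).obj U) :
    IsDominant (g ≫ reducedHom hw) ∧
      IsAdmissible j (w ∘ (Hom.base g).toOrderHom) ∧
      len j (w ∘ (Hom.base g).toOrderHom) (Fin.last U.unop.n) = m := by
  obtain ⟨h₁, h₂⟩ := (notMem_horn_iff hw g).1 hg
  have hadm := hw.isAdmissible_comp hk (Hom.base g).toOrderHom.monotone h₁
  refine ⟨⟨hadm.surj, fun i ↦ ?_⟩, hadm, ?_⟩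
  · obtain ⟨l, hl⟩ := exists_covers (reducedBase hw) (reducedBase_surj hw _)
      (reducedBase_surj hw _) i
    obtain ⟨l', h, hs⟩ := h₂ l
    refine ⟨l', covers_comp_reducedHom hw g h hl, ?_⟩
    rw [comp_reducedHom_vert hw g h hl, surjective_comp_eqToHom]
    exact hs
  · rw [hw.len_comp_eq hk (Hom.base g).toOrderHom.monotone h₁,
      map_last_of_hits (Hom.base g).toOrderHom.monotone (h₁ _ hk.lt_last.ne')]
    rfl

/-- If `g` misses at most the pivot, it is in the horn for a vertical reason, and its composite is
in the boundary. If it misses another vertex, its length drops below `m`. -/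
lemma reducedCell_mem_of_mem_horn
    (hg : g ∈ (Subfunctor.range (horizontalHornInclusion (reducedShape hw) k)).obj U) :
    (reducedCell hw).app U g ∈ (lengthFiltration j m).obj U := by
  by_cases h₁ : ∀ i, i ≠ k → ∃ x, (Hom.base g).toOrderHom x = i
  · left
    left
    by_contra hd
    have hd' := (isDominant_iff (g ≫ reducedHom hw)).2 hd
    refine (notMem_horn_iff hw g).2 ⟨h₁, fun i ↦ ?_⟩ hg
    by_cases hki : ∃ k, Covers (reducedBase hw) i k
    · obtain ⟨k', hk'⟩ := hki
      obtain ⟨l, h, hs⟩ := hd'.vert k'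
      obtain ⟨i', hi', hk''⟩ := covers_comp.1 (show Covers (Hom.base g ≫ reducedBase hw) l k' from h)
      obtain rfl := hk''.unique hk'
      rw [comp_reducedHom_vert hw g hi' hk'', surjective_comp_eqToHom] at hs
      exact ⟨l, hi', hs⟩
    -- The entry at `i` is 0, so every operator into it is surjective; some `l` covers `i` because
    -- `g` hits both ends, which differ from the pivot.
    · obtain ⟨l, hl⟩ := exists_covers (Hom.base g) (h₁ _ hk.pos.ne) (h₁ _ hk.lt_last.ne') i
      exact ⟨l, hl, surjective_of_eq_zero (reducedShape_q_of_not hw hki) _⟩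
  · push Not at h₁
    obtain ⟨i, hi, hgi⟩ := h₁
    exact Or.inr ⟨Or.inr fun x hx ↦ hw.above _ hx,
      hw.len_comp_lt hk (Hom.base g).toOrderHom.monotone hi hgi⟩

end ReducedCell

/-! ### Attaching the horns and assembling the filtrations. -/

lemma exists_reducedCell {j : Fin (θ.n + 1)} {m : ℕ} {U : Theta2ᵒᵖ} {c : (cylinder θ).obj U}
    (hc : IsAdmissible j (cellPath c)) (hm : len j (cellPath c) (Fin.last _) = m) :
    ∃ (w : Fin (m + 1) → Vertex θ.n) (hw : IsReduced j w) (g : U.unop ⟶ reducedShape hw),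
      (reducedCell hw).app U g = c := by
  obtain ⟨w, hw, hwv, -⟩ := hc.exists_isReduced hm
  have hle (x) : len j (cellPath c) x < m + 1 :=
    Nat.lt_succ_of_le (hm ▸ len_mono j (cellPath c) (Fin.le_last x))
  -- Each vertex goes to the position given by the length of the path up to it.
  let g : ⦋U.unop.n⦌ ⟶ ⦋m⦌ := SimplexCategory.mkHom
    ⟨fun x ↦ ⟨len j (cellPath c) x, hle x⟩, fun x y h ↦ len_mono j (cellPath c) h⟩
  have hg (x) : w (g.toOrderHom x) = cellPath c x := hwv _ x rfl
  obtain ⟨g', hg', hf⟩ := exists_lift hw (Prod.snd c) g (by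
    ext x
    exact congr_arg (fun a : Vertex θ.n ↦ a.2.val) (hg x).symm)
  refine ⟨w, hw, g', Prod.ext (funext fun x ↦ ?_) hf⟩
  have := congr_arg Prod.fst (hg x)
  rw [← hg'] at this
  exact this

/-- One horn is attached for each reduced path with `m + 1` vertices. Every new cell has length
exactly `m` and factors through such a path; `IsReduced.unique` and `reducedShape_hom_ext` show that
it does so only once off the horns. -/
theorem lengthFiltration_mem (W : MorphismProperty CellularSet) [W.IsStableUnderCobaseChange]
    [MorphismProperty.IsStableUnderTransfiniteComposition.{0} W] (hW : innerHorizontalHorns ≤ W)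
    (hn : 0 < θ.n) (j : Fin (θ.n + 1)) (m : ℕ) :
    W (Subfunctor.homOfLe (lengthFiltration_le_succ (j := j) m)) := by
  choose k hk using fun i : {w : Fin (m + 1) → Vertex θ.n // IsReduced j w} ↦
    i.2.exists_isPivot hn
  have hmem (i) (U) (g : U.unop ⟶ reducedShape i.2)
      (hg : g ∉ (Subfunctor.range (horizontalHornInclusion (reducedShape i.2) (k i))).obj U) :
      (reducedCell i.2).app U g ∉ (fibreFiltration θ j).obj U ∧
        len j (cellPath ((reducedCell i.2).app U g)) (Fin.last _) = m := by
    obtain ⟨h₁, h₂, h₃⟩ := isDominant_of_notMem_horn i.2 (hk i) hg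
    exact ⟨notMem_of_isAdmissible h₁ h₂, h₃⟩
  refine Subfunctor.homOfLe_mem_of_attach_finite W _
    (fun i : {w : Fin (m + 1) → Vertex θ.n // IsReduced j w} ↦ cellRep (reducedShape i.2))
    (fun i ↦ reducedCell i.2)
    (fun i ↦ Subfunctor.range (horizontalHornInclusion (reducedShape i.2) (k i)))
    (fun i ↦ range_horn_ι_mem _ W hW _ (hk i).pos (hk i).lt_last) ?_ ?_ ?_ ?_
  · intro i U g
    by_cases hg : g ∈ (Subfunctor.range (horizontalHornInclusion (reducedShape i.2) (k i))).obj U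
    · exact lengthFiltration_le_succ m _ (reducedCell_mem_of_mem_horn i.2 (hk i) hg)
    · exact Or.inr ⟨Or.inr fun x hx ↦ i.2.above _ hx, by rw [(hmem i U g hg).2]; omega⟩
  · intro i U g
    refine ⟨fun h ↦ ?_, reducedCell_mem_of_mem_horn i.2 (hk i)⟩
    by_contra hg
    obtain ⟨h₁, h₂⟩ := hmem i U g hg
    rcases h with h | ⟨-, h⟩
    · exact h₁ h
    · omega
  · intro U c hc
    by_cases hc' : c ∈ (lengthFiltration j m).obj U
    · exact Or.inl hc'
    · right
      obtain ⟨h₁, h₂⟩ : c ∈ (fibreFiltration θ (j + 1)).obj U ∧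
          len j (cellPath c) (Fin.last _) < m + 1 := by
        rcases hc with hc | hc
        · exact absurd (Or.inl hc) hc'
        · exact hc
      obtain ⟨-, ha⟩ := isAdmissible_of_mem h₁ fun h ↦ hc' (Or.inl h)
      have hm : len j (cellPath c) (Fin.last _) = m := by
        by_contra hne
        exact hc' (Or.inr ⟨h₁, by omega⟩)
      obtain ⟨w, hw, g, hg⟩ := exists_reducedCell ha hm
      exact ⟨⟨w, hw⟩, g, hg⟩
  · rintro ⟨w, hw⟩ ⟨w', hw'⟩ U g g' hg hg' h
    have h₁ : w ∘ (Hom.base g).toOrderHom = w' ∘ (Hom.base g').toOrderHom := congr_arg cellPath h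
    obtain ⟨rfl, h₂⟩ := hw.unique (hk ⟨w, hw⟩) (Hom.base g).toOrderHom.monotone
      ((notMem_horn_iff hw g).1 hg).1 hw' (hk ⟨w', hw'⟩) (Hom.base g').toOrderHom.monotone
      ((notMem_horn_iff hw' g').1 hg').1 h₁
    exact ⟨rfl, reducedShape_hom_ext hw (by
      ext x
      exact congr_arg Fin.val (congr_fun h₂ x)) (congr_arg Prod.snd h)⟩

theorem fibreFiltration_mem (W : MorphismProperty CellularSet) [W.IsStableUnderCobaseChange]
    [MorphismProperty.IsStableUnderTransfiniteComposition.{0} W] (hW : innerHorizontalHorns ≤ W)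
    (hn : 0 < θ.n) (j : ℕ) (hj : j ≤ θ.n + 1) :
    W (Subfunctor.homOfLe (fibreFiltration_mono (θ := θ) (Nat.zero_le j))) := by
  induction j with
  | zero => exact Subfunctor.homOfLe_self_mem W _ le_rfl
  | succ j ih =>
    refine Subfunctor.homOfLe_trans_mem W (fibreFiltration_mono (Nat.zero_le j))
      (fibreFiltration_mono (Nat.le_succ j)) (ih (by omega)) ?_
    let i : Fin (θ.n + 1) := ⟨j, by omega⟩
    have h₁ : W (Subfunctor.homOfLe (le_iSup (lengthFiltration i) 0)) :=
      Subfunctor.homOfLe_iSup_mem W (lengthFiltration i) (fun m ↦ lengthFiltration_le_succ m)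
        (fun m ↦ lengthFiltration_mem W hW hn i m)
    have key {A A' B B' : Subfunctor (cylinder θ)} (hA : A = A') (hB : B = B') (h : A ≤ B)
        (h' : A' ≤ B') (hh : W (Subfunctor.homOfLe h)) : W (Subfunctor.homOfLe h') := by
      subst hA hB
      exact hh
    exact key lengthFiltration_zero iSup_lengthFiltration _ _ h₁

theorem cylinderEnd_ι_mem (W : MorphismProperty CellularSet) [W.IsStableUnderCobaseChange]
    [MorphismProperty.IsStableUnderTransfiniteComposition.{0} W] (hW : innerHorizontalHorns ≤ W)
    (hn : 0 < θ.n) : W (cylinderEnd θ).ι := by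
  have h := fibreFiltration_mem W hW hn (θ.n + 1) le_rfl
  have key {A B : Subfunctor (cylinder θ)} (hB : B = ⊤) (h : A ≤ B)
      (hh : W (Subfunctor.homOfLe h)) : W A.ι := by
    subst hB
    rw [← Subfunctor.homOfLe_ι h]
    exact W.comp_mem _ _ hh (W.of_isIso _)
  rw [← fibreFiltration_zero]
  exact key fibreFiltration_last _ h

/-- `cell` of a class contains the class obtained by replacing an arrow by an isomorphic one. -/
theorem cellClosure_of_arrow_iso {S : MorphismProperty CellularSet} {X Y X' Y' : CellularSet}
    {f : X ⟶ Y} {f' : X' ⟶ Y'} (e : Arrow.mk f ≅ Arrow.mk f') (hf : cellClosure S f) :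
    cellClosure S f' := fun W hS hW hW' ↦ (W.arrow_mk_iso_iff e).1 (hf W hS hW hW')

theorem cellClosure_le_of_le {S T : MorphismProperty CellularSet} (h : S ≤ cellClosure T) :
    cellClosure S ≤ cellClosure T :=
  fun _ _ _ hf W hT hW hW' ↦ hf W (fun _ _ g hg ↦ h g hg W hT hW hW') hW hW'

theorem le_cellClosure (S : MorphismProperty CellularSet) : S ≤ cellClosure S :=
  fun _ _ g hg _ hS _ _ ↦ hS g hg

theorem cellClosure_mono {S T : MorphismProperty CellularSet} (h : S ≤ T) :
    cellClosure S ≤ cellClosure T :=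
  cellClosure_le_of_le (h.trans (le_cellClosure T))

theorem Theta2.n_pos_of_ne_zero {θ : Theta2} (h : θ ≠ Theta2.zero) : 0 < θ.n := by
  by_contra hn
  refine h ?_
  obtain ⟨n, q⟩ := θ
  obtain rfl : n = 0 := by simpa using hn
  exact congr_arg (Theta2.mk 0) (funext fun i ↦ i.elim0)

theorem cellClosure_horizontalEquivalenceExtension (hθ : θ ≠ Theta2.zero) :
    cellClosure innerHorizontalHorns (horizontalEquivalenceExtension θ).hom :=
  cellClosure_of_arrow_iso (horizontalEquivalenceExtensionIso θ).symm
    fun W hS _ _ ↦ cylinderEnd_ι_mem W hS (n_pos_of_ne_zero hθ)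

/-- ∂Θ₂[0] is empty: every operator to [0] is dominant. -/
lemma notMem_boundary_zero {U : Theta2ᵒᵖ} (f : U.unop ⟶ Theta2.zero) :
    f ∉ (Subfunctor.range (boundaryInclusion Theta2.zero)).obj U :=
  (isDominant_iff f).1 ⟨fun _ ↦ ⟨0, Subsingleton.elim (α := Fin 1) _ _⟩, fun k ↦ k.elim0⟩

instance (U : Theta2) : Unique (U ⟶ Theta2.zero) where
  default := toZero U
  uniq _ := toZero_unique _ _

/-- The isomorphism `J ≅ cylinder [0]`. -/
def cellJIso : cellJ ≅ cylinder Theta2.zero :=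
  NatIso.ofComponents
    (fun U ↦ Equiv.toIso (((Codiscrete.equivFun (X := ULift Bool) (n := U.unop.n)).trans
      (Equiv.arrowCongr (Equiv.refl _) Equiv.ulift)).trans
        (Equiv.prodUnique _ (U.unop ⟶ Theta2.zero)).symm))
    (by
      intro U V g
      ext c
      exact Prod.ext rfl (toZero_unique _ _))

/-- The map `e` is isomorphic to the horizontal equivalence extension indexed by `[0]`. -/
def eMapIso : Arrow.mk eMap ≅ horizontalEquivalenceExtension Theta2.zero :=
  (Arrow.isoMk (Iso.refl _) cellJIso (Category.id_comp _) :
    Arrow.mk eMap ≅ Arrow.mk (eMap ≫ cellJIso.hom)) ≪≫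
  Subfunctor.arrowIsoOfInjective (eMap ≫ cellJIso.hom) (cylinderEnd Theta2.zero) (fun U ↦ by
    refine Function.Injective.comp (g := cellJIso.hom.app U) ?_ (eMap_injective U)
    rw [← mono_iff_injective]
    infer_instance) (fun U ⟨u, f⟩ ↦ by
      refine (mem_cylinderEnd _ u f).trans ⟨?_, ?_⟩
      · rintro (h | h)
        · exact ⟨f, Prod.ext (funext fun x ↦ (h x).symm) (toZero_unique _ _)⟩
        · exact absurd h (notMem_boundary_zero f)
      · rintro ⟨t, ht⟩
        exact Or.inl fun x ↦ (congr_fun (congr_arg Prod.fst ht) x).symm) ≪≫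
  (horizontalEquivalenceExtensionIso Theta2.zero).symm

end

theorem mainTheorem9 :
    (∀ θ : Theta2, θ ≠ Theta2.zero →
      cellClosure innerHorizontalHorns (horizontalEquivalenceExtension θ).hom) ∧
    cellClosure (innerHorizontalHorns ⊔ horizontalEquivalenceExtensions) =
      cellClosure (innerHorizontalHorns ⊔ MorphismProperty.ofHoms (fun _ : Unit ↦ eMap)) := by
  refine ⟨fun θ hθ ↦ cellClosure_horizontalEquivalenceExtension hθ, le_antisymm ?_ ?_⟩
  · refine cellClosure_le_of_le (sup_le (le_sup_left.trans (le_cellClosure _)) ?_)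
    rintro _ _ _ ⟨θ⟩
    by_cases hθ : θ = Theta2.zero
    · subst hθ
      exact cellClosure_of_arrow_iso eMapIso
        (le_cellClosure _ _ (le_sup_right (a := innerHorizontalHorns) _ (.mk ())))
    · exact cellClosure_mono le_sup_left _ (cellClosure_horizontalEquivalenceExtension hθ)
  · refine cellClosure_le_of_le (sup_le (le_sup_left.trans (le_cellClosure _)) ?_)
    rintro _ _ _ ⟨_⟩
    exact cellClosure_of_arrow_iso eMapIso.symm
      (le_cellClosure _ _ (le_sup_right (a := innerHorizontalHorns) _ (.mk Theta2.zero)))
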